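/- Conventions. Let $R$ be a ring and $n$ a positive integer; modules are left modules, and right $R$-modules are identified with $R^{\mathrm{op}}$-modules. $\mathcal H^n_R$ denotes the full subcategory of the $R$-modules $M$ that have projective dimension exactly $n$, satisfy $\operatorname{Ext}^i_R(M,R)=0$ for all $i\neq n$, and have a projective resolution by finitely generated $R$-modules; by convention the zero module also belongs to $\mathcal H^n_R$. Put $\operatorname{tr}^n_R(M)=\operatorname{Ext}^n_R(M,R)$, an $R^{\mathrm{op}}$-module via right multiplication on $R$. Let $K$ be a field. A $K$-algebra $R$ is called generalized Artin–Schelter regular of dimension $n$ (as an ungraded ring) if: (i) either $R$ is semiperfect and two-sided Noetherian, or $R$ has a $K$-algebra grading $R=\bigoplus_{i\ge 0}R_i$ with $R_0\cong K^t$ as $K$-algebras for some $t$, $\dim_K R_i<\infty$ for all $i$, and $R_{\ge 1}$ finitely generated both as a left and as a right $R$-module; (ii) $R$ and $R^{\mathrm{op}}$ have global dimension $n$; (iii) every simple $R$-module and every simple $R^{\mathrm{op}}$-module of projective dimension $n$ lies in $\mathcal H^n_R$, respectively $\mathcal H^n_{R^{\mathrm{op}}}$, and $\operatorname{tr}^n$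 sends each of these simple modules to a module having a simple submodule that belongs to $\mathcal H^n$ of the opposite side. (In (iii) all modules are arbitrary, ungraded modules.) A nonzero class $\eta\in\operatorname{Ext}^n_R(C,A)$ is an $n$-fold almost split extension if, for every epimorphism $f\colon X\to C$ of $R$-modules that does not split, the pullback $\eta\cdot f\in\operatorname{Ext}^n_R(X,A)$ is zero, and, for every monomorphism $g\colon A\to Y$ of $R$-modules that does not split, the pushout $g\cdot\eta\in\operatorname{Ext}^n_R(C,Y)$ is zero. Theorem. Let $K$ be an algebraically closed field, $n\ge 1$, and $\Lambda=K[x_1,\dots,x_n]$. All modules are ungraded. (1) Every simple $\Lambda$-module $S$ lies in $\mathcal H^n_\Lambda$, and $\operatorname{tr}^n_\Lambda(S)\cong S$ as $\Lambda$-modules (where $\Lambda^{\mathrm{op}}=\Lambda$). (2) $\Lambda$ is a generalized Artin–Schelter regular $K$-algebra of dimension $n$ as an ungraded ring. (3) $\mathcal H^n_\Lambda$ is exactly the full subcategory of all $\Lambda$-modules of finite length. (4) Corollary. The category $\mathcal H^n_\Lambda$ of $\Lambda$-modules of finite length has $n$-fold almost split extensions (sequences): for every indecomposable $C$ in $\mathcal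 H^n_\Lambda$ there are an indecomposable $A$ in $\mathcal H^n_\Lambda$ and an $n$-fold almost split extension in $\operatorname{Ext}^n_\Lambda(C,A)$, and for every indecomposable $A$ in $\mathcal H^n_\Lambda$ there are an indecomposable $C$ in $\mathcal H^n_\Lambda$ and an $n$-fold almost split extension in $\operatorname{Ext}^n_\Lambda(C,A)$. Moreover, if $n=1$, then $\mathcal H^1_\Lambda$ has almost split sequences in the classical sense: every indecomposable object of $\mathcal H^1_\Lambda$ is the right-hand term of one, and the left-hand term of one, with all terms in $\mathcal H^1_\Lambda$ and both end terms indecomposable. Here a short exact sequence $0\to A\to B\to C\to 0$ is almost split if it does not split, every homomorphism $X\to C$ of $\Lambda$-modules that is not a split epimorphism factors through $B\to C$, and every homomorphism $A\to Y$ of $\Lambda$-modules that is not a split monomorphism factors through $A\to B$. -/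

import Mathlib

open CategoryTheory CategoryTheory.Abelian

universe u

namespace ASRegular

section General

variable (R : Type u) [Ring R]

/-- The (left) global dimension: the supremum of the projective dimensions of all left modules. -/
noncomputable def globalDimension : WithBot ℕ∞ :=
  ⨆ M : ModuleCat.{u} R, projectiveDimension M

/-- The regular left module `R`. -/
abbrev regular : ModuleCat.{u} R := ModuleCat.of R R

variable {R}

/-- Right multiplication by `r`, an endomorphism of the regular left module. -/
def mulRight (r : R) : regular R ⟶ regular R :=
  ModuleCat.ofHom
    { toFun := fun x => x * r
      map_add' := fun x y => add_mul x y r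
      map_smul' := fun a x => mul_assoc a x r }

lemma mulRight_one : mulRight (1 : R) = 𝟙 (regular R) := by
  ext
  simp [mulRight]

lemma mulRight_zero : mulRight (0 : R) = 0 := by
  ext
  simp [mulRight]

lemma mulRight_add (r s : R) : mulRight (r + s) = mulRight r + mulRight s := by
  ext
  simp [mulRight]

lemma mulRight_mul (r s : R) : mulRight (r * s) = mulRight r ≫ mulRight s := by
  ext
  simp [mulRight]

/-- The right `R`-module structure on `Ext^n_R(M, R)` that is induced by the right multiplications
on the second argument. -/
@[reducible]
noncomputable def extRightModule (n : ℕ) (M : ModuleCat.{u} R) :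
    Module Rᵐᵒᵖ (Ext M (regular R) n) where
  smul r x := x.comp (Ext.mk₀ (mulRight r.unop)) (add_zero n)
  one_smul x := by
    change x.comp (Ext.mk₀ (mulRight (1 : R))) (add_zero n) = x
    rw [mulRight_one, Ext.comp_mk₀_id]
  mul_smul r s x := by
    change x.comp (Ext.mk₀ (mulRight (s.unop * r.unop))) (add_zero n) =
      (x.comp (Ext.mk₀ (mulRight s.unop)) (add_zero n)).comp
        (Ext.mk₀ (mulRight r.unop)) (add_zero n)
    rw [mulRight_mul, ← Ext.mk₀_comp_mk₀, Ext.comp_assoc_of_third_deg_zero]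
  smul_zero r := Ext.zero_comp (X := M) (Y := regular R) (n := n)
    (Ext.mk₀ (mulRight r.unop)) n (add_zero n)
  smul_add r x y := Ext.add_comp x y (Ext.mk₀ (mulRight r.unop)) (add_zero n)
  add_smul r s x := by
    change x.comp (Ext.mk₀ (mulRight (r.unop + s.unop))) (add_zero n) =
      x.comp (Ext.mk₀ (mulRight r.unop)) (add_zero n) +
        x.comp (Ext.mk₀ (mulRight s.unop)) (add_zero n)
    rw [mulRight_add, Ext.mk₀_add, Ext.comp_add]
  zero_smul x := by
    change x.comp (Ext.mk₀ (mulRight (0 : R))) (add_zero n) = 0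
    rw [mulRight_zero, Ext.mk₀_zero, Ext.comp_zero]

/-- `tr^n(M) = Ext^n_R(M, R)`, as a module over the opposite ring. -/
noncomputable def tr (n : ℕ) (M : ModuleCat.{u} R) : ModuleCat.{u} Rᵐᵒᵖ :=
  letI := extRightModule n M
  ModuleCat.of Rᵐᵒᵖ (Ext M (regular R) n)

/-- A module over the double opposite ring, seen as a module over the ring. -/
noncomputable def ofOpOp (M : ModuleCat.{u} Rᵐᵒᵖᵐᵒᵖ) : ModuleCat.{u} R :=
  (ModuleCat.restrictScalars (RingEquiv.opOp R).toRingHom).obj M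

/-- Membership in `H^n_R`: the module has projective dimension `n` (or is zero: the zero module,
of projective dimension `-∞`, belongs to `H^n_R` by convention), `Ext^i_R(M, R) = 0` for `i ≠ n`,
and `M` has a projective resolution by finitely generated modules. -/
def MemH (n : ℕ) (M : ModuleCat.{u} R) : Prop :=
  (Limits.IsZero M ∨ projectiveDimension M = n) ∧
  (∀ i : ℕ, i ≠ n → Subsingleton (Ext M (regular R) i)) ∧
  ∃ P : ProjectiveResolution M, ∀ i : ℕ, Module.Finite R (P.complex.X i)

/-- `X` has a simple submodule that lies in `H^n_R`. -/
def HasSimpleSubmoduleInH (n : ℕ) (X : ModuleCat.{u} R) : Prop :=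
  ∃ T : Submodule R X, IsSimpleModule R T ∧ MemH n (ModuleCat.of R T)

variable (R)

/-- Semiperfect rings: `R / rad R` is semisimple and idempotents lift modulo `rad R`. -/
def IsSemiperfect : Prop :=
  IsSemisimpleRing (R ⧸ Ring.jacobson R) ∧
  ∀ e : R ⧸ Ring.jacobson R, IsIdempotentElem e →
    ∃ f : R, IsIdempotentElem f ∧ Ideal.Quotient.mk (Ring.jacobson R) f = e

/-- `R` is a positively graded `K`-algebra with `R₀ ≃ K^t`, all `R_i` finite-dimensional, and
`R_{≥ 1}` finitely generated as a left and as a right `R`-module. -/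
def HasPositiveGrading (K : Type u) [Field K] [Algebra K R] : Prop :=
  ∃ (𝒜 : ℕ → Submodule K R) (_ : GradedAlgebra 𝒜),
    (∃ t : ℕ, Nonempty (𝒜 0 ≃ₐ[K] (Fin t → K))) ∧
    (∀ i, FiniteDimensional K (𝒜 i)) ∧
    (∃ s : Finset R, (Submodule.span R (s : Set R) : Set R) =
      ((⨆ i : ℕ, 𝒜 (i + 1) : Submodule K R) : Set R)) ∧
    (∃ s : Finset R, (Submodule.span Rᵐᵒᵖ (s : Set R) : Set R) =
      ((⨆ i : ℕ, 𝒜 (i + 1) : Submodule K R) : Set R))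

/-- `R` is generalized Artin-Schelter regular of dimension `n` as an ungraded ring: all modules in
the conditions on simple modules are arbitrary (ungraded) left and right modules. -/
structure IsGeneralizedASRegular (K : Type u) [Field K] [Algebra K R] (n : ℕ) : Prop where
  semiperfect_or_graded :
    (IsSemiperfect R ∧ IsNoetherianRing R ∧ IsNoetherianRing Rᵐᵒᵖ) ∨ HasPositiveGrading R K
  globalDimension_eq : globalDimension R = n
  globalDimension_op_eq : globalDimension Rᵐᵒᵖ = n
  simple_mem : ∀ S : ModuleCat.{u} R, IsSimpleModule R S → projectiveDimension S = n → MemH n S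
  simple_mem_op : ∀ S : ModuleCat.{u} Rᵐᵒᵖ, IsSimpleModule Rᵐᵒᵖ S →
    projectiveDimension S = n → MemH n S
  tr_simple : ∀ S : ModuleCat.{u} R, IsSimpleModule R S → projectiveDimension S = n →
    HasSimpleSubmoduleInH n (tr n S)
  tr_simple_op : ∀ S : ModuleCat.{u} Rᵐᵒᵖ, IsSimpleModule Rᵐᵒᵖ S → projectiveDimension S = n →
    HasSimpleSubmoduleInH n (ofOpOp (tr n S))

variable {R}

/-- A non-zero class `η` in `Ext^n_R(C, A)` is an `n`-fold almost split extension if its pullback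
along every non-split epimorphism `X ⟶ C` and its pushout along every non-split monomorphism
`A ⟶ Y` vanish. -/
def IsAlmostSplitExtension {n : ℕ} {C A : ModuleCat.{u} R} (η : Ext C A n) : Prop :=
  η ≠ 0 ∧
  (∀ (X : ModuleCat.{u} R) (f : X ⟶ C), Epi f → ¬ IsSplitEpi f →
    (Ext.mk₀ f).comp η (zero_add n) = 0) ∧
  (∀ (Y : ModuleCat.{u} R) (g : A ⟶ Y), Mono g → ¬ IsSplitMono g →
    η.comp (Ext.mk₀ g) (add_zero n) = 0)

/-- The full subcategory `P` has `n`-fold almost split extensions: each of its indecomposable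
objects is the right end of one and the left end of one, the other end being an indecomposable
object of the subcategory, too. -/
def HasAlmostSplitExtensions (n : ℕ) (P : ModuleCat.{u} R → Prop) : Prop :=
  (∀ C : ModuleCat.{u} R, P C → Indecomposable C →
    ∃ A : ModuleCat.{u} R, P A ∧ Indecomposable A ∧
      ∃ η : Ext C A n, IsAlmostSplitExtension η) ∧
  (∀ A : ModuleCat.{u} R, P A → Indecomposable A →
    ∃ C : ModuleCat.{u} R, P C ∧ Indecomposable C ∧
      ∃ η : Ext C A n, IsAlmostSplitExtension η)

/-- Almost split sequences `0 ⟶ A ⟶ B ⟶ C ⟶ 0`: non-split short exact sequences such that every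
morphism to `C` that is not a split epimorphism factors through `B ⟶ C` and every morphism from `A`
that is not a split monomorphism factors through `A ⟶ B`. -/
def IsAlmostSplitSequence (S : ShortComplex (ModuleCat.{u} R)) : Prop :=
  S.ShortExact ∧ ¬ IsSplitEpi S.g ∧
  (∀ (X : ModuleCat.{u} R) (f : X ⟶ S.X₃), ¬ IsSplitEpi f → ∃ h : X ⟶ S.X₂, h ≫ S.g = f) ∧
  (∀ (Y : ModuleCat.{u} R) (f : S.X₁ ⟶ Y), ¬ IsSplitMono f → ∃ h : S.X₂ ⟶ Y, S.f ≫ h = f)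

/-- The full subcategory `P` has almost split sequences: each of its indecomposable objects is
the right end of one and the left end of one, with all terms in the subcategory and
indecomposable ends. -/
def HasAlmostSplitSequences (P : ModuleCat.{u} R → Prop) : Prop :=
  (∀ C : ModuleCat.{u} R, P C → Indecomposable C →
    ∃ S : ShortComplex (ModuleCat.{u} R), IsAlmostSplitSequence S ∧ Nonempty (S.X₃ ≅ C) ∧
      P S.X₁ ∧ P S.X₂ ∧ Indecomposable S.X₁) ∧
  (∀ A : ModuleCat.{u} R, P A → Indecomposable A →
    ∃ S : ShortComplex (ModuleCat.{u} R), IsAlmostSplitSequence S ∧ Nonempty (S.X₁ ≅ A) ∧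
      P S.X₂ ∧ P S.X₃ ∧ Indecomposable S.X₃)

end General

/-- For a commutative ring, a module over the opposite ring seen as a module over the ring. -/
noncomputable def ofOp {R : Type u} [CommRing R] (M : ModuleCat.{u} Rᵐᵒᵖ) : ModuleCat.{u} R :=
  (ModuleCat.restrictScalars (RingEquiv.toOpposite R).toRingHom).obj M

end ASRegular

/-! Everything rests on one computation. For all `Λ`-modules `M` and `N`, `Ext^n(M, N)` is the
quotient of `Hom_K(M, N)` by the span of the commutators `x_i ∘ z - z ∘ x_i`, naturally in both
arguments (`koszul_surjective`, `koszul_eq_zero_iff`, `mk₀_comp_koszul`, `koszul_comp_mk₀`). This is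
the top cohomology of the Koszul complex, reached without writing that complex down. For each
coordinate there is an exact sequence `0 → M[t] → M[t] → M → 0` with first map `t - x_k`, where
`x_k` acts on `M[t]` as `t`. Repeating this for all coordinates replaces `M` by the free module `Λ
⊗_K M`, and dimension shifting does the rest. It also gives `Ext^i = 0` for `i > n`.

Simple modules: by the Nullstellensatz a simple module `S` is one-dimensional, given by a point `a`.
The computation turns `Ext^n(S, Λ)` into `Λ/(x_i - a_i) ≅ S`. The elements `x_i - a_i` form a
regular sequence, so `Ext^i(S, Λ) = 0` for `i < n`.

Finite length: composition series carry the vanishing below degree `n` to all modules of finite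
length, and a simple quotient keeps `Ext^n(M, Λ)` nonzero. Conversely, vanishing below degree `n`
puts a regular sequence of length `n` into the annihilator of `M`. Since `dim Λ = n`, the ring
`Λ/ann M` is then Artinian.

Almost split extensions: for finite-dimensional `C`, the trace pairing between `Hom_K(C, X)` and
`Hom_K(X, C)` makes the commutators the exact annihilator of the `Λ`-linear maps. This is Serre
duality with trivial translate. The endomorphism ring of an indecomposable `C` of finite length is
local. A functional on it that kills the non-units and sends `1` to `1` has the form `f ↦ tr(φ f)`,
and the class of `φ` in `Ext^n(C, C)` is almost split. For `n = 1` this class is realized by a short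
exact sequence.

The arguments use a ring `R` with an isomorphism `e` from the polynomial ring, so that they apply to
`Λ` and to `Λᵐᵒᵖ` alike. -/

namespace ASRegular

/-! ### Adjoining one free coordinate: the sequence `M[t] → M[t] → M` -/

section PolynomialStep

open Polynomial

variable {K R : Type u} [Field K] [CommRing R] [Algebra K R] {n : ℕ}
  (e : MvPolynomial (Fin n) K ≃ₐ[K] R)

/-- The coordinate functions of a ring identified with a polynomial ring. -/
noncomputable def coord (i : Fin n) : R := e (MvPolynomial.X i)

lemma coord_induction {p : R → Prop} (hC : ∀ a : K, p (algebraMap K R a))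
    (hadd : ∀ r s, p r → p s → p (r + s)) (hX : ∀ r i, p r → p (r * coord e i)) (r : R) : p r := by
  obtain ⟨q, rfl⟩ := e.surjective r
  induction q using MvPolynomial.induction_on with
  | C a =>
    rw [← MvPolynomial.algebraMap_eq, e.commutes]
    exact hC a
  | add q q' h h' => simpa using hadd _ _ h h'
  | mul_X q i h => simpa [coord] using hX _ i h

/-- The homomorphism `R → R[t]` that replaces the `k`-th coordinate by `t`. -/
noncomputable def freeCoord (k : Fin n) : R →ₐ[K] R[X] :=
  (MvPolynomial.aeval fun i => if i = k then (X : R[X]) else C (coord e i)).comp e.symm.toAlgHom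

lemma freeCoord_self (k : Fin n) : freeCoord e k (coord e k) = X := by
  simp [freeCoord, coord]

lemma freeCoord_of_ne {k i : Fin n} (h : i ≠ k) : freeCoord e k (coord e i) = C (coord e i) := by
  simp [freeCoord, coord, h]

lemma freeCoord_algebraMap (k : Fin n) (a : K) :
    freeCoord e k (algebraMap K R a) = C (algebraMap K R a) := by
  simp [Polynomial.algebraMap_apply]

lemma eval_freeCoord (k : Fin n) (r : R) : (freeCoord e k r).eval (coord e k) = r := by
  induction r using coord_induction e with
  | hC a => rw [freeCoord_algebraMap, eval_C]
  | hadd r s hr hs => rw [map_add, eval_add, hr, hs]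
  | hX r i hr =>
    rw [map_mul, eval_mul, hr]
    by_cases h : i = k
    · rw [h, freeCoord_self, eval_X]
    · rw [freeCoord_of_ne e h, eval_C]

/-- Extension of a linear map to polynomials with coefficients in the modules. -/
noncomputable def polyMap {M N : Type u} [AddCommGroup M] [Module R M] [AddCommGroup N] [Module R N]
    (f : M →ₗ[R] N) : PolynomialModule R M →ₗ[R[X]] PolynomialModule R N where
  toFun := PolynomialModule.map R f
  map_add' := map_add _
  map_smul' p q := by simpa using PolynomialModule.map_smul R f p q

/-- The functor `M ↦ M[t]`, on which the `k`-th coordinate acts as `t`. -/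
noncomputable def step (k : Fin n) : ModuleCat.{u} R ⥤ ModuleCat.{u} R where
  obj M := (ModuleCat.restrictScalars (freeCoord e k).toRingHom).obj
    (ModuleCat.of R[X] (PolynomialModule R M))
  map f := (ModuleCat.restrictScalars (freeCoord e k).toRingHom).map
    (ModuleCat.ofHom (polyMap f.hom))
  map_id M := by
    ext (p : PolynomialModule R M)
    change PolynomialModule.map R LinearMap.id p = p
    induction p using PolynomialModule.induction_linear with
    | zero => simp
    | add p q hp hq => rw [map_add, hp, hq]
    | single i m => simp
  map_comp {M N P} f g := by
    ext (p : PolynomialModule R M)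
    change PolynomialModule.map R (g.hom ∘ₗ f.hom) p =
      PolynomialModule.map R g.hom (PolynomialModule.map R f.hom p)
    induction p using PolynomialModule.induction_linear with
    | zero => simp
    | add p q hp hq => rw [map_add, hp, hq, map_add, map_add]
    | single i m => simp

variable {e} in
/-- The monomial `m t^i`. -/
noncomputable def stepSingle {k : Fin n} {M : ModuleCat.{u} R} (i : ℕ) : M →+ (step e k).obj M :=
  ((PolynomialModule.lsingle R i : M →ₗ[R] PolynomialModule R M) : M →+ PolynomialModule R M)

lemma step_induction {k : Fin n} {M : ModuleCat.{u} R} {p : (step e k).obj M → Prop}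
    (zero : p 0) (add : ∀ x y, p x → p y → p (x + y))
    (single : ∀ i m, p (stepSingle i m)) (x : (step e k).obj M) : p x :=
  PolynomialModule.induction_linear (p := p) x zero add single

lemma step_map_single {k : Fin n} {M N : ModuleCat.{u} R} (f : M ⟶ N) (i : ℕ) (m : M) :
    (step e k).map f (stepSingle i m) = stepSingle i (f m) :=
  PolynomialModule.map_single R f.hom i m

lemma coord_smul_stepSingle_self {k : Fin n} {M : ModuleCat.{u} R} (i : ℕ) (m : M) :
    coord e k • (stepSingle i m : (step e k).obj M) = stepSingle (i + 1) m := by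
  change freeCoord e k (coord e k) • PolynomialModule.single R i m =
    PolynomialModule.single R (i + 1) m
  rw [freeCoord_self, ← monomial_one_one_eq_X, PolynomialModule.monomial_smul_single, one_smul,
    add_comm]

/-- The condition `freeCoord e k r = C r` expresses that `r` does not involve the `k`-th coordinate;
such scalars act coefficientwise. -/
lemma smul_stepSingle {k : Fin n} {M : ModuleCat.{u} R} {r : R} (hr : freeCoord e k r = C r)
    (i : ℕ) (m : M) :
    r • (stepSingle i m : (step e k).obj M) = stepSingle i (r • m) := by
  change freeCoord e k r • PolynomialModule.single R i m = PolynomialModule.single R i (r • m)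
  rw [hr, ← monomial_zero_left, PolynomialModule.monomial_smul_single, zero_add]

lemma step_map_smul {k : Fin n} {M : ModuleCat.{u} R} {r : R} (hr : freeCoord e k r = C r) :
    (step e k).map (r • 𝟙 M) = r • 𝟙 ((step e k).obj M) := by
  ext x
  induction x using step_induction with
  | zero => simp
  | add x y hx hy => rw [map_add, hx, hy, map_add]
  | single i m =>
    rw [step_map_single]
    exact (smul_stepSingle e hr i m).symm

instance (k : Fin n) : (step e k).Additive where
  map_add {_ _ f g} := by
    ext x
    induction x using step_induction with
    | zero => simp
    | add x y hx hy => rw [map_add, hx, hy, map_add]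
    | single i m =>
      change _ = (step e k).map f _ + (step e k).map g _
      rw [step_map_single, step_map_single, step_map_single, ← map_add]
      rfl

/-- Evaluation `M[t] → M` at the `k`-th coordinate. -/
noncomputable def stepEval (k : Fin n) (M : ModuleCat.{u} R) : (step e k).obj M ⟶ M :=
  ModuleCat.ofHom (X := (step e k).obj M) (Y := M)
    { toFun := fun p => PolynomialModule.eval (coord e k) (p : PolynomialModule R M)
      map_add' := fun p q => map_add (PolynomialModule.eval (coord e k)) p q
      map_smul' := fun r p => by
        refine (PolynomialModule.eval_smul (freeCoord e k r) p (coord e k)).trans ?_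
        rw [eval_freeCoord]
        rfl }

lemma stepEval_single {k : Fin n} {M : ModuleCat.{u} R} (i : ℕ) (m : M) :
    stepEval e k M (stepSingle i m) = coord e k ^ i • m :=
  PolynomialModule.eval_single (coord e k) i m

/-- The endomorphism `t - x_k` of `M[t]`. -/
noncomputable def stepDiff (k : Fin n) (M : ModuleCat.{u} R) :
    (step e k).obj M ⟶ (step e k).obj M :=
  coord e k • 𝟙 _ - (step e k).map (coord e k • 𝟙 M)

lemma stepDiff_single {k : Fin n} {M : ModuleCat.{u} R} (i : ℕ) (m : M) :
    stepDiff e k M (stepSingle i m) = stepSingle (i + 1) m - stepSingle i (coord e k • m) := by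
  rw [← coord_smul_stepSingle_self]
  exact congrArg (fun z => coord e k • (stepSingle i m : (step e k).obj M) - z)
    (step_map_single e (coord e k • 𝟙 M) i m)

/-- The coefficients of an element of `M[t]`. -/
noncomputable def stepCoeff {k : Fin n} {M : ModuleCat.{u} R} (i : ℕ) : (step e k).obj M →+ M :=
  (Finsupp.applyAddHom i).comp (PolynomialModule.coeffAddEquiv (R := R) (M := M)).toAddMonoidHom

lemma stepCoeff_single {k : Fin n} {M : ModuleCat.{u} R} (i j : ℕ) (m : M) :
    stepCoeff e i (stepSingle j m : (step e k).obj M) = if j = i then m else 0 :=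
  Finsupp.single_apply

lemma step_ext {k : Fin n} {M : ModuleCat.{u} R} {x : (step e k).obj M}
    (h : ∀ i, stepCoeff e i x = 0) : x = 0 :=
  PolynomialModule.ext (Finsupp.ext h)

lemma stepCoeff_eventually_zero {k : Fin n} {M : ModuleCat.{u} R} (x : (step e k).obj M) :
    ∃ d, ∀ i, d ≤ i → stepCoeff e i x = 0 := by
  induction x using step_induction with
  | zero => exact ⟨0, fun i _ => map_zero _⟩
  | add x y hx hy =>
    obtain ⟨a, ha⟩ := hx
    obtain ⟨b, hb⟩ := hy
    refine ⟨max a b, fun i hi => ?_⟩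
    rw [map_add, ha i (le_trans (le_max_left a b) hi), hb i (le_trans (le_max_right a b) hi),
      add_zero]
  | single i m =>
    refine ⟨i + 1, fun j hj => ?_⟩
    rw [stepCoeff_single, if_neg (by lia)]

lemma stepCoeff_stepDiff {k : Fin n} {M : ModuleCat.{u} R} (x : (step e k).obj M) (i : ℕ) :
    stepCoeff e (i + 1) (stepDiff e k M x) =
      stepCoeff e i x - coord e k • stepCoeff e (i + 1) x := by
  induction x using step_induction with
  | zero => simp
  | add x y hx hy =>
    simp only [map_add, hx, hy, smul_add]
    abel
  | single j m =>
    simp only [stepDiff_single, map_sub, stepCoeff_single, add_left_inj, smul_ite, smul_zero]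

/-- If `(t - x_k) p = 0`, each coefficient of `p` is `x_k` times the next one. The coefficients
vanish in high degrees, hence everywhere by descent. -/
lemma stepDiff_injective (k : Fin n) (M : ModuleCat.{u} R) :
    Function.Injective (stepDiff e k M) := by
  rw [injective_iff_map_eq_zero]
  intro x hx
  have key : ∀ i, stepCoeff e i x = coord e k • stepCoeff e (i + 1) x := fun i => by
    have := stepCoeff_stepDiff e x i
    rw [hx, map_zero] at this
    exact (sub_eq_zero.mp this.symm)
  obtain ⟨d, hd⟩ := stepCoeff_eventually_zero e x
  have : ∀ j i, d ≤ i + j → stepCoeff e i x = 0 := by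
    intro j
    induction j with
    | zero => exact fun i hi => hd i hi
    | succ j ih => exact fun i hi => by rw [key, ih (i + 1) (by lia), smul_zero]
  exact step_ext e fun i => this d i (by lia)

lemma stepDiff_eval (k : Fin n) (M : ModuleCat.{u} R) : stepDiff e k M ≫ stepEval e k M = 0 := by
  ext x
  induction x using step_induction with
  | zero => simp
  | add x y hx hy => rw [map_add, hx, hy, map_add]
  | single i m =>
    change stepEval e k M (stepDiff e k M (stepSingle i m)) = 0
    rw [stepDiff_single, map_sub, stepEval_single, stepEval_single, pow_succ, mul_smul, sub_self]

/-- Division by `t - x_k` with remainder the value at `t = x_k`. It yields exactness in the middle.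
-/
lemma exists_stepDiff_eq (k : Fin n) (M : ModuleCat.{u} R) (x : (step e k).obj M) :
    ∃ y, stepDiff e k M y = x - stepSingle 0 (stepEval e k M x) := by
  induction x using step_induction with
  | zero => exact ⟨0, by simp⟩
  | add x y hx hy =>
    obtain ⟨a, ha⟩ := hx
    obtain ⟨b, hb⟩ := hy
    exact ⟨a + b, by rw [map_add, ha, hb, map_add, map_add]; abel⟩
  | single i m =>
    induction i generalizing m with
    | zero => exact ⟨0, by rw [stepEval_single, pow_zero, one_smul, sub_self, map_zero]⟩
    | succ i ih =>
      obtain ⟨y, hy⟩ := ih (coord e k • m)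
      refine ⟨y + stepSingle i m, ?_⟩
      rw [map_add, hy, stepDiff_single, stepEval_single, stepEval_single, pow_succ, mul_smul]
      abel

/-- The complex `M[t] → M[t] → M`. -/
noncomputable def stepComplex (k : Fin n) (M : ModuleCat.{u} R) : ShortComplex (ModuleCat.{u} R) :=
  .mk (stepDiff e k M) (stepEval e k M) (stepDiff_eval e k M)

lemma stepComplex_shortExact (k : Fin n) (M : ModuleCat.{u} R) :
    (stepComplex e k M).ShortExact where
  exact := by
    rw [ShortComplex.moduleCat_exact_iff]
    intro (x : (step e k).obj M) (hx : stepEval e k M x = 0)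
    obtain ⟨y, hy⟩ := exists_stepDiff_eq e k M x
    rw [hx, map_zero, sub_zero] at hy
    exact ⟨y, hy⟩
  mono_f := (ModuleCat.mono_iff_injective _).mpr (stepDiff_injective e k M)
  epi_g := (ModuleCat.epi_iff_surjective _).mpr fun (m : M) =>
    ⟨(stepSingle 0 m : (step e k).obj M),
      (stepEval_single e 0 m).trans (by rw [pow_zero, one_smul])⟩

lemma step_map_stepDiff (k : Fin n) {M N : ModuleCat.{u} R} (f : M ⟶ N) :
    (step e k).map f ≫ stepDiff e k N = stepDiff e k M ≫ (step e k).map f := by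
  simp only [stepDiff, Preadditive.comp_sub, Preadditive.sub_comp, Linear.comp_smul,
    Linear.smul_comp, Category.comp_id, Category.id_comp, ← Functor.map_comp]

lemma step_map_stepEval (k : Fin n) {M N : ModuleCat.{u} R} (f : M ⟶ N) :
    (step e k).map f ≫ stepEval e k N = stepEval e k M ≫ f := by
  ext x
  induction x using step_induction with
  | zero => simp
  | add x y hx hy => rw [map_add, hx, hy, map_add]
  | single i m =>
    change stepEval e k N ((step e k).map f (stepSingle i m)) =
      f (stepEval e k M (stepSingle i m))
    rw [step_map_single, stepEval_single, stepEval_single, map_smul]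

/-- The class of `M[t] → M[t] → M`. -/
noncomputable def stepClass (k : Fin n) (M : ModuleCat.{u} R) : Ext M ((step e k).obj M) 1 :=
  (stepComplex_shortExact e k M).extClass

lemma stepClass_naturality (k : Fin n) {M N : ModuleCat.{u} R} (f : M ⟶ N) :
    (stepClass e k M).comp (Ext.mk₀ ((step e k).map f)) (add_zero 1) =
      (Ext.mk₀ f).comp (stepClass e k N) (zero_add 1) :=
  ShortComplex.ShortExact.extClass_naturality
    (f := { τ₁ := (step e k).map f, τ₂ := (step e k).map f, τ₃ := f
            comm₁₂ := step_map_stepDiff e k f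
            comm₂₃ := step_map_stepEval e k f })
    (stepComplex_shortExact e k M) (stepComplex_shortExact e k N)

/-- Extension of an additive map to `M[t]`, with `t` sent to the `k`-th coordinate. -/
noncomputable def stepLift (k : Fin n) {M N : ModuleCat.{u} R} (g : M →+ N) :
    (step e k).obj M →+ N :=
  (Finsupp.liftAddHom fun i => (DistribSMul.toAddMonoidHom N (coord e k ^ i)).comp g).comp
    (PolynomialModule.coeffAddEquiv (R := R) (M := M)).toAddMonoidHom

lemma stepLift_single (k : Fin n) {M N : ModuleCat.{u} R} (g : M →+ N) (i : ℕ) (m : M) :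
    stepLift e k g (stepSingle i m) = coord e k ^ i • g m := by
  exact Finsupp.liftAddHom_apply_single _ i m

lemma stepLift_coord_smul (k : Fin n) {M N : ModuleCat.{u} R} (g : M →+ N)
    (x : (step e k).obj M) : stepLift e k g (coord e k • x) = coord e k • stepLift e k g x := by
  induction x using step_induction with
  | zero => simp
  | add x y hx hy => rw [smul_add, map_add, hx, hy, map_add, smul_add]
  | single i m =>
    rw [coord_smul_stepSingle_self, stepLift_single, stepLift_single, pow_succ', mul_smul]

lemma stepLift_smul (k : Fin n) {M N : ModuleCat.{u} R} (g : M →+ N) {r : R}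
    (hr : freeCoord e k r = C r) (hg : ∀ m, g (r • m) = r • g m)
    (x : (step e k).obj M) : stepLift e k g (r • x) = r • stepLift e k g x := by
  induction x using step_induction with
  | zero => simp
  | add x y hx hy => rw [smul_add, map_add, hx, hy, map_add, smul_add]
  | single i m =>
    rw [smul_stepSingle e hr, stepLift_single, stepLift_single, hg, smul_smul, smul_smul, mul_comm]

/-- Only compatibility with `t` is required, so the lemma can be iterated over a list of coordinates
with merely additive maps. -/
lemma step_hom_ext (k : Fin n) {M N : ModuleCat.{u} R} {g h : (step e k).obj M →+ N}
    (hg : ∀ x, g (coord e k • x) = coord e k • g x) (hh : ∀ x, h (coord e k • x) = coord e k • h x)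
    (H : ∀ m, g (stepSingle 0 m) = h (stepSingle 0 m)) : g = h := by
  ext x
  induction x using step_induction with
  | zero => simp
  | add x y hx hy => rw [map_add, hx, hy, map_add]
  | single i m =>
    induction i with
    | zero => exact H m
    | succ i ih => rw [← coord_smul_stepSingle_self, hg, hh, ih]

end PolynomialStep

/-! ### Iterated steps and dimension shifting -/

section KoszulPresentation

open Polynomial

variable {K R : Type u} [Field K] [CommRing R] [Algebra K R] {n : ℕ}
  (e : MvPolynomial (Fin n) K ≃ₐ[K] R)

lemma stepClass_comp_naturality (k : Fin n) {M N Y : ModuleCat.{u} R} (f : M ⟶ N) {i j : ℕ}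
    (y : Ext ((step e k).obj N) Y i) (h : 1 + i = j) :
    (stepClass e k M).comp ((Ext.mk₀ ((step e k).map f)).comp y (zero_add i)) h =
      (Ext.mk₀ f).comp ((stepClass e k N).comp y h) (zero_add j) := by
  rw [← Ext.comp_assoc_of_second_deg_zero, stepClass_naturality]
  exact Ext.comp_assoc _ _ _ _ h (by lia)

/-- The iteration of the functors `step` along a list of coordinates. -/
noncomputable def multi : List (Fin n) → (ModuleCat.{u} R ⥤ ModuleCat.{u} R)
  | [] => 𝟭 _
  | k :: L => multi L ⋙ step e k

/-- The inclusion of the constants. -/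
noncomputable def multiUnit : ∀ (L : List (Fin n)) (M : ModuleCat.{u} R), M →+ (multi e L).obj M
  | [], M => AddMonoidHom.id M
  | _ :: L, M => (stepSingle 0).comp (multiUnit L M)

lemma multi_map_unit (L : List (Fin n)) {M N : ModuleCat.{u} R} (f : M ⟶ N) (m : M) :
    (multi e L).map f (multiUnit e L M m) = multiUnit e L N (f m) := by
  induction L with
  | nil => rfl
  | cons k L ih => exact (step_map_single e _ 0 _).trans (congrArg (stepSingle 0) ih)

lemma smul_multiUnit {L : List (Fin n)} {r : R} (hr : ∀ k ∈ L, freeCoord e k r = C r)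
    (M : ModuleCat.{u} R) (m : M) : r • multiUnit e L M m = multiUnit e L M (r • m) := by
  induction L with
  | nil => rfl
  | cons k L ih =>
    exact (smul_stepSingle e (hr k List.mem_cons_self) 0 _).trans
      (congrArg (stepSingle 0) (ih fun l hl => hr l (List.mem_cons_of_mem _ hl)))

lemma multi_map_smul {L : List (Fin n)} {r : R} (hr : ∀ k ∈ L, freeCoord e k r = C r)
    (M : ModuleCat.{u} R) : (multi e L).map (r • 𝟙 M) = r • 𝟙 ((multi e L).obj M) := by
  induction L with
  | nil => rfl
  | cons k L ih =>
    refine Eq.trans (congrArg (step e k).map (ih fun l hl => hr l (List.mem_cons_of_mem _ hl))) ?_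
    exact step_map_smul e (hr k List.mem_cons_self)

/-- Extension of an additive map from the constants. -/
noncomputable def multiLift : ∀ (L : List (Fin n)) {M N : ModuleCat.{u} R},
    (M →+ N) → ((multi e L).obj M →+ N)
  | [], _, _, g => g
  | k :: L, _, _, g => stepLift e k (multiLift L g)

lemma multiLift_unit (L : List (Fin n)) {M N : ModuleCat.{u} R} (g : M →+ N) (m : M) :
    multiLift e L g (multiUnit e L M m) = g m := by
  induction L with
  | nil => rfl
  | cons k L ih =>
    refine (stepLift_single e k _ 0 _).trans ?_
    rw [pow_zero, one_smul, ih]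

lemma multiLift_smul {L : List (Fin n)} {r : R} (hr : ∀ k ∈ L, freeCoord e k r = C r)
    {M N : ModuleCat.{u} R} (g : M →+ N) (hg : ∀ m, g (r • m) = r • g m)
    (x : (multi e L).obj M) : multiLift e L g (r • x) = r • multiLift e L g x := by
  induction L with
  | nil => exact hg x
  | cons k L ih =>
    exact stepLift_smul e k _ (hr k List.mem_cons_self)
      (fun m => ih (fun l hl => hr l (List.mem_cons_of_mem _ hl)) m) x

lemma multiLift_coord_smul {L : List (Fin n)} (hL : L.Nodup) {l : Fin n} (hl : l ∈ L)
    {M N : ModuleCat.{u} R} (g : M →+ N) (x : (multi e L).obj M) :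
    multiLift e L g (coord e l • x) = coord e l • multiLift e L g x := by
  induction L with
  | nil => simp at hl
  | cons k L ih =>
    by_cases h : l = k
    · subst h
      exact stepLift_coord_smul e l _ x
    · exact stepLift_smul e k _ (freeCoord_of_ne e h)
        (fun m => ih (List.nodup_cons.mp hL).2 ((List.mem_cons.mp hl).resolve_left h) m) x

lemma multi_hom_ext {L : List (Fin n)} (hL : L.Nodup) {M N : ModuleCat.{u} R}
    {g h : (multi e L).obj M →+ N}
    (hg : ∀ l ∈ L, ∀ x, g (coord e l • x) = coord e l • g x)
    (hh : ∀ l ∈ L, ∀ x, h (coord e l • x) = coord e l • h x)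
    (H : ∀ m, g (multiUnit e L M m) = h (multiUnit e L M m)) : g = h := by
  induction L with
  | nil => exact AddMonoidHom.ext H
  | cons k L ih =>
    refine step_hom_ext e k (hg k List.mem_cons_self) (hh k List.mem_cons_self) fun m => ?_
    refine DFunLike.congr_fun (ih (List.nodup_cons.mp hL).2 (g := g.comp (stepSingle 0))
      (h := h.comp (stepSingle 0)) ?_ ?_ H) m
    all_goals
      intro l hl x
      have hlk : l ≠ k := fun h => (List.nodup_cons.mp hL).1 (h ▸ hl)
      have := smul_stepSingle e (freeCoord_of_ne e hlk) 0 x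
    · exact (congrArg g this).symm.trans (hg l (List.mem_cons_of_mem _ hl) _)
    · exact (congrArg h this).symm.trans (hh l (List.mem_cons_of_mem _ hl) _)

/-- The iterated extension class. -/
noncomputable def multiClass : ∀ (L : List (Fin n)) (M : ModuleCat.{u} R),
    Ext M ((multi e L).obj M) L.length
  | [], M => Ext.mk₀ (𝟙 M)
  | k :: L, M => (multiClass L M).comp (stepClass e k ((multi e L).obj M)) rfl

lemma multiClass_naturality (L : List (Fin n)) {M N : ModuleCat.{u} R} (f : M ⟶ N) :
    (multiClass e L M).comp (Ext.mk₀ ((multi e L).map f)) (add_zero _) =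
      (Ext.mk₀ f).comp (multiClass e L N) (zero_add _) := by
  induction L with
  | nil =>
    refine (Ext.mk₀_comp_mk₀ _ _).trans (Eq.trans ?_ (Ext.mk₀_comp_mk₀ _ _).symm)
    exact congrArg Ext.mk₀ ((Category.id_comp f).trans (Category.comp_id f).symm)
  | cons k L ih =>
    change ((multiClass e L M).comp (stepClass e k ((multi e L).obj M)) rfl).comp
      (Ext.mk₀ ((step e k).map ((multi e L).map f))) (add_zero (L.length + 1)) =
      (Ext.mk₀ f).comp ((multiClass e L N).comp (stepClass e k ((multi e L).obj N)) rfl)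
        (zero_add (L.length + 1))
    rw [Ext.comp_assoc_of_third_deg_zero, stepClass_naturality,
      ← Ext.comp_assoc_of_second_deg_zero, ih]
    exact Ext.comp_assoc _ _ _ _ rfl (by lia)

variable {e} in
/-- A map on `multi e L` of a module that commutes with the coordinates in a full list. -/
lemma smul_comm_of_coord {M N : ModuleCat.{u} R} {g : M →+ N}
    (hK : ∀ (a : K) (m : M), g (algebraMap K R a • m) = algebraMap K R a • g m)
    (hX : ∀ (i : Fin n) (m : M), g (coord e i • m) = coord e i • g m) (r : R) (m : M) :
    g (r • m) = r • g m := by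
  induction r using coord_induction e generalizing m with
  | hC a => exact hK a m
  | hadd r s hr hs => rw [add_smul, map_add, hr, hs, add_smul]
  | hX r i hr => rw [mul_smul, hr, hX, mul_smul]

/-- The `R`-linear map on `multi e L`, for a full list `L`, extending a `K`-linear map. -/
noncomputable def multiDesc {L : List (Fin n)} (hL : L.Nodup) (hL' : ∀ i, i ∈ L)
    {M N : ModuleCat.{u} R} (g : M →+ N)
    (hg : ∀ (a : K) (m : M), g (algebraMap K R a • m) = algebraMap K R a • g m) :
    (multi e L).obj M ⟶ N :=
  ModuleCat.ofHom
    { multiLift e L g with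
      map_smul' := smul_comm_of_coord (e := e) (g := multiLift e L g)
        (fun a => multiLift_smul e (fun k _ => freeCoord_algebraMap e k a) g (hg a))
        (fun i => multiLift_coord_smul e hL (hL' i) g) }

lemma multiDesc_unit {L : List (Fin n)} (hL : L.Nodup) (hL' : ∀ i, i ∈ L)
    {M N : ModuleCat.{u} R} (g : M →+ N)
    (hg : ∀ (a : K) (m : M), g (algebraMap K R a • m) = algebraMap K R a • g m) (m : M) :
    multiDesc e hL hL' g hg (multiUnit e L M m) = g m :=
  multiLift_unit e L g m

lemma multi_hom_ext' {L : List (Fin n)} (hL : L.Nodup) {M N : ModuleCat.{u} R}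
    {g h : (multi e L).obj M ⟶ N}
    (H : ∀ m, g (multiUnit e L M m) = h (multiUnit e L M m)) : g = h := by
  ext x
  exact DFunLike.congr_fun (multi_hom_ext e hL (g := g.hom.toAddMonoidHom)
    (h := h.hom.toAddMonoidHom) (fun l _ => map_smul g.hom _) (fun l _ => map_smul h.hom _) H) x

/-- For a full list the module is `R ⊗_K M`: an `R`-linear map out of it amounts to a `K`-linear map
on the constants, and epimorphisms split over the field `K`. -/
lemma multi_projective {L : List (Fin n)} (hL : L.Nodup) (hL' : ∀ i, i ∈ L)
    (M : ModuleCat.{u} R) : Projective ((multi e L).obj M) where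
  factors {E F} f p hp := by
    let := Module.compHom M (algebraMap K R)
    let := Module.compHom E (algebraMap K R)
    let := Module.compHom F (algebraMap K R)
    let p' : E →ₗ[K] F := { p.hom.toAddMonoidHom with map_smul' := fun a => map_smul p.hom _ }
    obtain ⟨s, hs⟩ := p'.exists_rightInverse_of_surjective
      (LinearMap.range_eq_top.mpr ((ModuleCat.epi_iff_surjective p).mp hp))
    let g : M →+ F := f.hom.toAddMonoidHom.comp (multiUnit e L M)
    have hg (a : K) (m : M) : g (a • m) = a • g m :=
      (congrArg f (smul_multiUnit e (fun k _ => freeCoord_algebraMap e k a) M m).symm).trans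
        (map_smul f.hom _ _)
    refine ⟨multiDesc e hL hL' (s.toAddMonoidHom.comp g) fun a m => ?_, ?_⟩
    · exact (congrArg s (hg a m)).trans (map_smul s a _)
    · refine multi_hom_ext' e hL fun m => ?_
      refine (congrArg p (multiDesc_unit e hL hL' _ _ m)).trans ?_
      exact LinearMap.congr_fun hs (g m)

/-- Each free coordinate lowers the bound on the projective dimension by one. The induction runs on
the number `d` of coordinates missing from `L`: a full list gives a projective module, and otherwise
the sequence for a missing `k` places the group between two that vanish by induction. The empty list
bounds every projective dimension by `n`. -/
lemma ext_multi_eq_zero {L : List (Fin n)} (hL : L.Nodup) (M N : ModuleCat.{u} R) {i : ℕ}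
    (hi : n < i + L.length) (y : Ext ((multi e L).obj M) N i) : y = 0 := by
  have hlen : L.length ≤ n := by simpa using hL.length_le_card
  obtain ⟨d, hd⟩ : ∃ d, L.length + d = n := ⟨n - L.length, by lia⟩
  induction d generalizing L i with
  | zero =>
    have hL' : ∀ i, i ∈ L := fun i => by
      have : L.toFinset = Finset.univ := Finset.eq_univ_of_card _ (by
        rw [List.toFinset_card_of_nodup hL, Fintype.card_fin]; lia)
      exact List.mem_toFinset.mp (this ▸ Finset.mem_univ i)
    have := multi_projective e hL hL' M
    obtain ⟨i, rfl⟩ : ∃ j, i = j + 1 := ⟨i - 1, by lia⟩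
    exact y.eq_zero_of_projective
  | succ d ih =>
    obtain ⟨k, hk⟩ : ∃ k, k ∉ L := by
      by_contra! h
      have := Finset.card_le_card (fun x _ => List.mem_toFinset.mpr (h x) :
        (Finset.univ : Finset (Fin n)) ⊆ L.toFinset)
      rw [Finset.card_fin, List.toFinset_card_of_nodup hL] at this
      lia
    have hkL : (k :: L).Nodup := List.nodup_cons.mpr ⟨hk, hL⟩
    obtain ⟨i, rfl⟩ : ∃ j, i = 1 + j := ⟨i - 1, by lia⟩
    obtain ⟨z, rfl⟩ := Ext.contravariant_sequence_exact₃
      (stepComplex_shortExact e k ((multi e L).obj M)) N y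
      (ih hkL (by simp only [List.length_cons]; lia) _ (by simp only [List.length_cons]; lia)
        (by simp only [List.length_cons]; lia)) rfl
    rw [show z = 0 from ih hkL (by simp only [List.length_cons]; lia) z
      (by simp only [List.length_cons]; lia) (by simp only [List.length_cons]; lia)]
    exact Ext.comp_zero _ _ _ _ rfl

include e in
lemma ext_eq_zero_of_lt (M N : ModuleCat.{u} R) {i : ℕ} (hi : n < i) (y : Ext M N i) : y = 0 :=
  ext_multi_eq_zero e List.nodup_nil M N hi y

/-- At each step the obstruction to lifting through the connecting map lies in an `Ext` group that
`ext_multi_eq_zero` kills. -/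
lemma multiClass_comp_surjective {L : List (Fin n)} (hL : L.Nodup) (M N : ModuleCat.{u} R) {j : ℕ}
    (hj : L.length + j = n) (y : Ext M N n) :
    ∃ w : Ext ((multi e L).obj M) N j, (multiClass e L M).comp w hj = y := by
  induction L generalizing j with
  | nil =>
    obtain rfl : j = n := by simpa using hj
    exact ⟨y, Ext.mk₀_id_comp y⟩
  | cons k L ih =>
    simp only [List.length_cons] at hj
    obtain ⟨w, rfl⟩ := ih (List.nodup_cons.mp hL).2 (j := 1 + j) (by lia)
    obtain ⟨z, rfl⟩ := Ext.contravariant_sequence_exact₃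
      (stepComplex_shortExact e k ((multi e L).obj M)) N w
      (ext_multi_eq_zero e hL M N (by simp only [List.length_cons]; lia) _) rfl
    exact ⟨z, Ext.comp_assoc _ _ _ _ _ (by lia)⟩

/-- The difference of the two actions of the `l`-th coordinate. -/
noncomputable def multiDiff (L : List (Fin n)) (l : Fin n) (M : ModuleCat.{u} R) :
    (multi e L).obj M ⟶ (multi e L).obj M :=
  coord e l • 𝟙 _ - (multi e L).map (coord e l • 𝟙 M)

/-- Since `k` is not in `L`, the `k`-th coordinate acts on `multi e L` of `M` through its action on
`M`. -/
lemma multiDiff_cons_self {k : Fin n} {L : List (Fin n)} (hk : k ∉ L) (M : ModuleCat.{u} R) :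
    multiDiff e (k :: L) k M = stepDiff e k ((multi e L).obj M) := by
  have := multi_map_smul e (L := L) (r := coord e k)
    (fun l hl => freeCoord_of_ne e fun h => hk (h ▸ hl)) M
  rw [stepDiff, ← this]
  rfl

lemma multiDiff_cons_of_ne {k l : Fin n} (h : l ≠ k) (L : List (Fin n)) (M : ModuleCat.{u} R) :
    multiDiff e (k :: L) l M = (step e k).map (multiDiff e L l M) := by
  refine Eq.symm (((step e k).map_sub).trans ?_)
  rw [step_map_smul e (freeCoord_of_ne e h)]
  rfl

/-- The kernel of the iterated connecting map. By induction the image of `w` under the last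
connecting map is a sum of differences for the coordinates in `L`. The terms `z l` lift along this
map, which is surjective in this degree, and naturality moves the differences across it. What
remains is killed by the connecting map, so it comes from `t - x_k`. -/
lemma exists_eq_sum_of_multiClass_comp_eq_zero {L : List (Fin n)} (hL : L.Nodup)
    (M N : ModuleCat.{u} R) {j : ℕ} (hj : L.length + j = n) (w : Ext ((multi e L).obj M) N j)
    (hw : (multiClass e L M).comp w hj = 0) :
    ∃ z : Fin n → Ext ((multi e L).obj M) N j,
      w = (L.map fun l => (Ext.mk₀ (multiDiff e L l M)).comp (z l) (zero_add j)).sum := by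
  induction L generalizing j with
  | nil =>
    obtain rfl : j = n := by simpa using hj
    exact ⟨0, (Ext.mk₀_id_comp w).symm.trans hw⟩
  | cons k L ih =>
    have hkL := (List.nodup_cons.mp hL).1
    simp only [List.length_cons] at hj
    have hw' : (multiClass e L M).comp ((stepClass e k ((multi e L).obj M)).comp w rfl)
        (show L.length + (1 + j) = n by lia) = 0 :=
      (Ext.comp_assoc _ _ _ _ _ (by lia)).symm.trans hw
    obtain ⟨z, hz⟩ := ih (List.nodup_cons.mp hL).2 _ _ hw'
    have hsurj (l : Fin n) : ∃ v : Ext ((multi e (k :: L)).obj M) N j,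
        (stepClass e k ((multi e L).obj M)).comp v rfl = z l :=
      Ext.contravariant_sequence_exact₃
        (stepComplex_shortExact e k ((multi e L).obj M)) N (z l)
        (ext_multi_eq_zero e hL M N (by simp only [List.length_cons]; lia) _) rfl
    choose v hv using hsurj
    have hdiff : (stepClass e k ((multi e L).obj M)).comp
        (w - (L.map fun l => (Ext.mk₀ (multiDiff e (k :: L) l M)).comp (v l) (zero_add j)).sum)
          rfl = 0 := by
      refine (map_sub ((stepClass e k ((multi e L).obj M)).precomp N rfl) _ _).trans ?_
      refine (congrArg (· - _) hz).trans (sub_eq_zero.mpr ?_)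
      refine Eq.symm ((map_list_sum ((stepClass e k ((multi e L).obj M)).precomp N rfl) _).trans ?_)
      refine congrArg List.sum (List.map_map.trans (List.map_congr_left fun l hl => ?_))
      have hlk : l ≠ k := fun h => hkL (h ▸ hl)
      change (stepClass e k ((multi e L).obj M)).comp
        ((Ext.mk₀ (multiDiff e (k :: L) l M)).comp (v l) (zero_add j)) rfl = _
      rw [multiDiff_cons_of_ne e hlk, ← hv l]
      exact stepClass_comp_naturality e k (multiDiff e L l M) (v l) rfl
    obtain ⟨t, ht⟩ : ∃ t : Ext ((multi e (k :: L)).obj M) N j, _ = _ :=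
      Ext.contravariant_sequence_exact₁
        (stepComplex_shortExact e k ((multi e L).obj M)) N _ rfl hdiff
    -- The lifts `v` serve the coordinates in `L`; the value at the new coordinate `k` is the
    -- preimage `t` of the remainder.
    refine ⟨Function.update v k t, ?_⟩
    rw [List.map_cons, List.sum_cons, Function.update_self, multiDiff_cons_self e hkL]
    refine (sub_eq_iff_eq_add.mp ht.symm).trans (congrArg (_ + ·) (congrArg List.sum ?_))
    refine List.map_congr_left fun l hl => ?_
    rw [Function.update_of_ne (ne_of_mem_of_not_mem hl hkL)]

end KoszulPresentation

/-! ### `Ext^n` as `K`-linear maps modulo commutators -/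

section Koszul

open scoped ModuleCat

variable {K R : Type u} [Field K] [CommRing R] [Algebra K R] {n : ℕ}
  (e : MvPolynomial (Fin n) K ≃ₐ[K] R)

/-- The `R`-linear extension of a `K`-linear map to the free module `multi e L` over a full
list. -/
noncomputable def koszulDesc {M N : ModuleCat.{u} R} (g : M →ₗ[K] N) :
    (multi e (List.finRange n)).obj M ⟶ N :=
  multiDesc e (List.nodup_finRange n) List.mem_finRange g.toAddMonoidHom fun a m => by
    simp

lemma koszulDesc_unit {M N : ModuleCat.{u} R} (g : M →ₗ[K] N) (m : M) :
    koszulDesc e g (multiUnit e _ M m) = g m :=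
  multiDesc_unit e _ _ _ _ m

lemma koszulDesc_ext {M N : ModuleCat.{u} R} {g h : (multi e (List.finRange n)).obj M ⟶ N}
    (H : ∀ m, g (multiUnit e _ M m) = h (multiUnit e _ M m)) : g = h :=
  multi_hom_ext' e (List.nodup_finRange n) H

lemma exists_koszulDesc_eq {M N : ModuleCat.{u} R} (f : (multi e (List.finRange n)).obj M ⟶ N) :
    ∃ g : M →ₗ[K] N, koszulDesc e g = f := by
  refine ⟨{ f.hom.toAddMonoidHom.comp (multiUnit e _ M) with map_smul' := fun a m => ?_ }, ?_⟩
  · change f (multiUnit e _ M (a • m)) = a • f (multiUnit e _ M m)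
    rw [← algebraMap_smul R a m, ← algebraMap_smul R a (f _),
      ← smul_multiUnit e fun k _ => freeCoord_algebraMap e k a]
    exact map_smul f.hom _ _
  · exact koszulDesc_ext e fun m => koszulDesc_unit e _ m

/-- The class in `Ext^n(M, N)` of a `K`-linear map `M → N`. -/
noncomputable def koszul {M N : ModuleCat.{u} R} (g : M →ₗ[K] N) : Ext M N n :=
  (multiClass e (List.finRange n) M).comp (Ext.mk₀ (koszulDesc e g)) (by simp)

lemma koszul_surjective {M N : ModuleCat.{u} R} (y : Ext M N n) :
    ∃ g : M →ₗ[K] N, koszul e g = y := by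
  obtain ⟨w, rfl⟩ := multiClass_comp_surjective e (List.nodup_finRange n) M N (j := 0) (by simp) y
  obtain ⟨f, rfl⟩ := (Ext.mk₀_bijective _ _).2 w
  obtain ⟨g, rfl⟩ := exists_koszulDesc_eq e f
  exact ⟨g, rfl⟩

lemma mk₀_comp_koszul {M M' N : ModuleCat.{u} R} (f : M' ⟶ M) (g : M →ₗ[K] N)
    {g' : M' →ₗ[K] N} (h : ∀ m, g' m = g (f m)) :
    (Ext.mk₀ f).comp (koszul e g) (zero_add n) = koszul e g' := by
  have : koszulDesc e g' = (multi e _).map f ≫ koszulDesc e g := koszulDesc_ext e fun m => by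
    rw [koszulDesc_unit, h]
    exact ((congrArg (koszulDesc e g) (multi_map_unit e _ f m)).trans
      (koszulDesc_unit e g _)).symm
  rw [koszul, koszul, this, ← Ext.mk₀_comp_mk₀, ← Ext.comp_assoc_of_second_deg_zero,
    multiClass_naturality]
  exact (Ext.comp_assoc _ _ _ _ (by simp) (by simp)).symm

lemma koszul_comp_mk₀ {M N N' : ModuleCat.{u} R} (g : M →ₗ[K] N) (f : N ⟶ N')
    {g' : M →ₗ[K] N'} (h : ∀ m, g' m = f (g m)) :
    (koszul e g).comp (Ext.mk₀ f) (add_zero n) = koszul e g' := by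
  have : koszulDesc e g' = koszulDesc e g ≫ f := koszulDesc_ext e fun m => by
    rw [koszulDesc_unit, h]
    exact (congrArg f (koszulDesc_unit e g m)).symm
  rw [koszul, koszul, this, ← Ext.mk₀_comp_mk₀, Ext.comp_assoc_of_third_deg_zero]

lemma koszul_add {M N : ModuleCat.{u} R} (g h : M →ₗ[K] N) :
    koszul e (g + h) = koszul e g + koszul e h := by
  have : koszulDesc e (g + h) = koszulDesc e g + koszulDesc e h := koszulDesc_ext e fun m => by
    rw [koszulDesc_unit]
    exact (congrArg₂ (· + ·) (koszulDesc_unit e g m) (koszulDesc_unit e h m)).symm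
  rw [koszul, koszul, koszul, this, Ext.mk₀_add, Ext.comp_add]

/-- `koszul` as an additive map. -/
noncomputable def koszulHom (M N : ModuleCat.{u} R) : (M →ₗ[K] N) →+ Ext M N n :=
  AddMonoidHom.mk' (koszul e) (koszul_add e)

/-- The action of the `i`-th coordinate. -/
noncomputable def coordMul (i : Fin n) (M : ModuleCat.{u} R) : M →ₗ[K] M where
  toFun m := coord e i • m
  map_add' := smul_add _
  map_smul' _ _ := smul_comm _ _ _

/-- By naturality the two terms are the class of `g` acted on by `x_i` through `N` and through `M`;
these two actions on `Ext` agree. -/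
lemma koszul_commutator {M N : ModuleCat.{u} R} (i : Fin n) (g : M →ₗ[K] N) :
    koszul e (coordMul e i N ∘ₗ g - g ∘ₗ coordMul e i M) = 0 := by
  refine (map_sub (koszulHom e M N) _ _).trans (sub_eq_zero.mpr ?_)
  change koszul e _ = koszul e _
  rw [← koszul_comp_mk₀ e g (coord e i • 𝟙 N) (g' := coordMul e i N ∘ₗ g) fun _ => rfl,
    ← mk₀_comp_koszul e (coord e i • 𝟙 M) g (g' := g ∘ₗ coordMul e i M) fun _ => rfl]
  simp [Ext.mk₀_smul]

lemma koszulDesc_multiDiff {M N : ModuleCat.{u} R} (i : Fin n) (g : M →ₗ[K] N) (m : M) :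
    (multiDiff e (List.finRange n) i M ≫ koszulDesc e g) (multiUnit e _ M m) =
      coord e i • g m - g (coord e i • m) := by
  have : multiDiff e (List.finRange n) i M (multiUnit e _ M m) =
      coord e i • multiUnit e _ M m - multiUnit e _ M (coord e i • m) :=
    congrArg (coord e i • multiUnit e _ M m - ·) (multi_map_unit e _ (coord e i • 𝟙 M) m)
  rw [ModuleCat.comp_apply, this, map_sub, map_smul, koszulDesc_unit, koszulDesc_unit]

/-- For the full list and `j = 0`, the kernel found above consists of maps out of `R ⊗_K M`.
Restricted to the constants, the differences become commutators. -/
lemma koszul_eq_zero_iff {M N : ModuleCat.{u} R} (g : M →ₗ[K] N) :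
    koszul e g = 0 ↔ ∃ z : Fin n → (M →ₗ[K] N),
      g = ∑ i, (coordMul e i N ∘ₗ z i - z i ∘ₗ coordMul e i M) := by
  constructor
  · intro h
    obtain ⟨w, hw⟩ := exists_eq_sum_of_multiClass_comp_eq_zero e (List.nodup_finRange n) M N
      (j := 0) (by simp) _ h
    have hz (l : Fin n) : ∃ z : M →ₗ[K] N, Ext.mk₀ (koszulDesc e z) = w l := by
      obtain ⟨f, hf⟩ := (Ext.mk₀_bijective _ _).2 (w l)
      obtain ⟨g, rfl⟩ := exists_koszulDesc_eq e f
      exact ⟨g, hf⟩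
    choose z hz using hz
    refine ⟨z, ?_⟩
    rw [← List.ofFn_eq_map, List.sum_ofFn] at hw
    have key : koszulDesc e g = ∑ i, multiDiff e _ i M ≫ koszulDesc e (z i) := by
      apply (Ext.mk₀_bijective _ _).1
      rw [Ext.mk₀_sum, hw]
      exact Finset.sum_congr rfl fun i _ => by rw [← hz i, Ext.mk₀_comp_mk₀]
    ext m
    rw [← koszulDesc_unit e g, key]
    refine (DFunLike.congr_fun (map_sum ModuleCat.homAddEquiv _ _)
      (multiUnit e (List.finRange n) M m)).trans ?_
    rw [LinearMap.sum_apply, LinearMap.sum_apply]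
    exact Finset.sum_congr rfl fun i _ => koszulDesc_multiDiff e i (z i) m
  · rintro ⟨z, rfl⟩
    refine (map_sum (koszulHom e M N) _ _).trans (Finset.sum_eq_zero fun i _ => ?_)
    exact koszul_commutator e i (z i)

end Koszul

/-! ### Simple modules and their transpose -/

section Simple

open scoped ModuleCat

variable {K R : Type u} [Field K] [CommRing R] [Algebra K R] {n : ℕ}

/-- Nullstellensatz: `S` is `R/I` with `I` maximal, and `R/I` is a finite extension of the
algebraically closed field `K`. -/
lemma exists_character [IsAlgClosed K] [Algebra.FiniteType K R] (S : ModuleCat.{u} R)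
    [IsSimpleModule R S] : ∃ χ : R →ₐ[K] K, ∀ (r : R) (m : S), r • m = χ r • m := by
  obtain ⟨I, hI, ⟨f⟩⟩ := isSimpleModule_iff_quot_maximal.mp ‹IsSimpleModule R S›
  let : Field (R ⧸ I) := Ideal.Quotient.field I
  have : Module.Finite K (R ⧸ I) := finite_of_finite_type_of_isJacobsonRing K (R ⧸ I)
  let b := AlgEquiv.ofBijective (Algebra.ofId K (R ⧸ I))
    (IsAlgClosed.algebraMap_bijective_of_isIntegral)
  refine ⟨b.symm.toAlgHom.comp (Ideal.Quotient.mkₐ K I), fun r m => ?_⟩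
  have key : Ideal.Quotient.mk I (algebraMap K R (b.symm (Ideal.Quotient.mk I r))) =
      Ideal.Quotient.mk I r := b.apply_symm_apply _
  refine Eq.trans ?_ (algebraMap_smul R _ m)
  apply f.injective
  rw [map_smul, map_smul]
  obtain ⟨x, hx⟩ := Ideal.Quotient.mk_surjective (f m)
  rw [← hx]
  change Ideal.Quotient.mk I (r * x) =
    Ideal.Quotient.mk I (algebraMap K R (b.symm (Ideal.Quotient.mk I r)) * x)
  rw [map_mul, map_mul, key]

/-- A generator and coordinate functional of a simple module. -/
lemma exists_generator (S : ModuleCat.{u} R) [IsSimpleModule R S] {χ : R →ₐ[K] K}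
    (hχ : ∀ (r : R) (m : S), r • m = χ r • m) :
    ∃ (s : S) (l : S →ₗ[K] K), l s = 1 ∧ ∀ m, m = l m • s := by
  have : Nontrivial S := IsSimpleModule.nontrivial R S
  obtain ⟨s, hs⟩ := exists_ne (0 : S)
  have hbij : Function.Bijective (LinearMap.toSpanSingleton K S s) := by
    refine ⟨smul_left_injective K hs, fun m => ?_⟩
    obtain ⟨r, rfl⟩ := IsSimpleModule.toSpanSingleton_surjective R hs m
    exact ⟨χ r, (hχ r s).symm⟩
  let b := LinearEquiv.ofBijective _ hbij
  refine ⟨s, b.symm.toLinearMap, ?_, fun m => (b.apply_symm_apply m).symm⟩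
  exact b.injective ((b.apply_symm_apply s).trans (one_smul K s).symm)

variable (e : MvPolynomial (Fin n) K ≃ₐ[K] R)

lemma sub_character_mem (χ : R →ₐ[K] K) (r : R) :
    r - algebraMap K R (χ r) ∈
      Ideal.span (Set.range fun i => coord e i - algebraMap K R (χ (coord e i))) := by
  induction r using coord_induction e with
  | hC a => simp
  | hadd r s hr hs => simpa [add_sub_add_comm] using add_mem hr hs
  | hX r i hr =>
    have := add_mem (Ideal.mul_mem_right (coord e i) _ hr)
      (Ideal.mul_mem_left _ (algebraMap K R (χ r)) (Ideal.subset_span (Set.mem_range_self i)))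
    convert this using 1
    simp only [map_mul]
    ring

/-- Evaluation of the first `k` coordinates at a point. -/
noncomputable def partialEval (χ : R →ₐ[K] K) (k : ℕ) : R →ₐ[K] R :=
  (MvPolynomial.aeval fun i : Fin n =>
    if (i : ℕ) < k then algebraMap K R (χ (coord e i)) else coord e i).comp e.symm.toAlgHom

lemma partialEval_coord (χ : R →ₐ[K] K) (k : ℕ) (i : Fin n) :
    partialEval e χ k (coord e i) =
      if (i : ℕ) < k then algebraMap K R (χ (coord e i)) else coord e i := by
  simp [partialEval, coord]

/-- The list of the functions `x_i - a_i`. -/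
noncomputable def shiftedCoords (χ : R →ₐ[K] K) : List R :=
  List.ofFn fun i => coord e i - algebraMap K R (χ (coord e i))

/-- Identifies the ideal of the first `k` shifted coordinates with the kernel of an endomorphism of
the domain `R`, which makes regularity easy to check. -/
lemma mem_ofList_take_iff (χ : R →ₐ[K] K) (k : ℕ) (r : R) :
    r ∈ Ideal.ofList ((shiftedCoords e χ).take k) ↔ partialEval e χ k r = 0 := by
  have key (i : Fin n) (hi : (i : ℕ) < k) : coord e i - algebraMap K R (χ (coord e i)) ∈
      Ideal.ofList ((shiftedCoords e χ).take k) := by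
    apply Ideal.subset_span
    simp [shiftedCoords, List.mem_take_iff_getElem]
    exact ⟨i, by lia, rfl⟩
  constructor
  · intro hr
    have : Ideal.ofList ((shiftedCoords e χ).take k) ≤ RingHom.ker (partialEval e χ k) := by
      refine Ideal.span_le.mpr fun x hx => ?_
      simp [shiftedCoords, List.mem_take_iff_getElem] at hx
      obtain ⟨i, hi, rfl⟩ := hx
      simp [partialEval_coord, hi]
    exact this hr
  · intro hr
    have (r : R) : r - partialEval e χ k r ∈ Ideal.ofList ((shiftedCoords e χ).take k) := by
      induction r using coord_induction e with
      | hC a => simp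
      | hadd r s hr hs => simpa [add_sub_add_comm] using add_mem hr hs
      | hX r i hr =>
        rw [map_mul, partialEval_coord]
        split_ifs with h
        · have := add_mem (Ideal.mul_mem_right (coord e i) _ hr)
            (Ideal.mul_mem_left _ (partialEval e χ k r) (key i h))
          convert this using 1
          ring
        · rw [← sub_mul]
          exact Ideal.mul_mem_right _ _ hr
    simpa [hr] using this r

include e in
lemma isDomain_of_algEquiv : IsDomain R := e.symm.toMulEquiv.isDomain _

lemma coord_sub_ne_zero (i : Fin n) (a : K) : coord e i - algebraMap K R a ≠ 0 := by
  intro h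
  have := congrArg e.symm h
  simp only [coord, map_sub, AlgEquiv.symm_apply_apply, AlgEquiv.commutes, map_zero] at this
  have := congrArg (MvPolynomial.coeff (Finsupp.single i 1)) this
  simp [MvPolynomial.algebraMap_eq, MvPolynomial.coeff_C, Finsupp.single_eq_zero, eq_comm] at this

/-- The quotient by the first `i` elements embeds into the domain `R` by `partialEval`, which fixes
the next, nonzero, element. -/
lemma shiftedCoords_isWeaklyRegular (χ : R →ₐ[K] K) :
    RingTheory.Sequence.IsWeaklyRegular R (shiftedCoords e χ) := by
  have := isDomain_of_algEquiv e
  rw [RingTheory.Sequence.isWeaklyRegular_iff]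
  intro i hi
  simp only [shiftedCoords, List.length_ofFn] at hi
  rw [isSMulRegular_iff_right_eq_zero_of_smul]
  intro x hx
  obtain ⟨r, rfl⟩ := Submodule.Quotient.mk_surjective _ x
  rw [← Submodule.Quotient.mk_smul] at hx
  rw [Submodule.Quotient.mk_eq_zero] at hx ⊢
  rw [smul_eq_mul, Ideal.mul_top, mem_ofList_take_iff] at hx ⊢
  have : (shiftedCoords e χ)[i]'(by simpa [shiftedCoords]) =
    coord e ⟨i, hi⟩ - algebraMap K R (χ (coord e ⟨i, hi⟩)) := by simp [shiftedCoords]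
  rw [smul_eq_mul, this, map_mul, map_sub, partialEval_coord, if_neg (by simp),
    AlgHom.commutes] at hx
  exact (mul_eq_zero.mp hx).resolve_left (coord_sub_ne_zero e _ _)

lemma smul_ofList_lt_top (χ : R →ₐ[K] K) :
    Ideal.ofList (shiftedCoords e χ) • (⊤ : Submodule R R) < ⊤ := by
  rw [lt_top_iff_ne_top, smul_eq_mul, Ideal.mul_top]
  intro h
  have : (1 : R) ∈ Ideal.ofList (shiftedCoords e χ) := h ▸ Submodule.mem_top
  rw [← List.take_length (l := shiftedCoords e χ), mem_ofList_take_iff, map_one] at this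
  have := isDomain_of_algEquiv e
  exact one_ne_zero ‹(1 : R) = 0›

include e in
-- Rees: `Ext` into `R` vanishes below the length of an `R`-regular sequence that annihilates `S`;
-- the shifted coordinates are such a sequence of length `n`.
lemma ext_simple_subsingleton [IsAlgClosed K] (S : ModuleCat.{u} R) [IsSimpleModule R S] {i : ℕ}
    (hi : i < n) : Subsingleton (Ext S (regular R) i) := by
  have : IsNoetherianRing R := isNoetherianRing_of_ringEquiv _ e.toRingEquiv
  have : Algebra.FiniteType K R := .equiv inferInstance e
  obtain ⟨χ, hχ⟩ := exists_character (K := K) S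
  refine ModuleCat.subsingleton_ext_of_exists_isRegular (Ideal.ofList (shiftedCoords e χ)) S ?_
    (regular R) (smul_ofList_lt_top e χ) (shiftedCoords e χ) (fun _ hr => Ideal.subset_span hr)
    ⟨shiftedCoords_isWeaklyRegular e χ, (smul_ofList_lt_top e χ).ne'⟩ i (by simpa [shiftedCoords])
  rw [Module.support_eq_zeroLocus]
  refine PrimeSpectrum.zeroLocus_anti_mono (Ideal.span_le.mpr fun x hx => ?_)
  simp only [shiftedCoords, List.mem_ofFn] at hx
  obtain ⟨i, rfl⟩ := hx
  refine Module.mem_annihilator.mpr fun m => ?_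
  rw [sub_smul, hχ, algebraMap_smul, sub_self]

/-- The class in `Ext^n(S, N)` of the map of rank one given by a functional and an element. -/
noncomputable def koszulRankOne {S N : ModuleCat.{u} R} (l : S →ₗ[K] K) : N →+ Ext S N n :=
  (koszulHom e S N).comp
    (AddMonoidHom.mk' (fun c : N => l.smulRight c) fun c d => by
      ext m
      exact smul_add _ _ _)

lemma koszulRankOne_comp_mk₀ {S N N' : ModuleCat.{u} R} (l : S →ₗ[K] K) (c : N) (f : N ⟶ N') :
    (koszulRankOne e l c).comp (Ext.mk₀ f) (add_zero n) = koszulRankOne e l (f c) := by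
  refine koszul_comp_mk₀ e _ f fun m => ?_
  change l m • f c = f (l m • c)
  rw [← algebraMap_smul R (l m) (f c), ← algebraMap_smul R (l m) c]
  exact (map_smul f.hom _ c).symm

lemma koszulRankOne_surjective {S N : ModuleCat.{u} R} {l : S →ₗ[K] K} {s : S}
    (hs : ∀ m, m = l m • s) : Function.Surjective (koszulRankOne e l : N →+ Ext S N n) := by
  intro y
  obtain ⟨g, rfl⟩ := koszul_surjective e y
  refine ⟨g s, congrArg (koszul e) ?_⟩
  ext m
  exact (g.map_smul (l m) s).symm.trans (congrArg g (hs m).symm)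

/-- On `S` the coordinates act by the scalars `χ (x_i)`, so a commutator with `x_i` is
multiplication by `x_i - χ (x_i)` on the target. Thus `Ext^n(S, N)` is the quotient of `N` by the
shifted coordinates. -/
lemma koszulRankOne_eq_zero_iff {S N : ModuleCat.{u} R} {l : S →ₗ[K] K} {s : S} (hl : l s = 1)
    {χ : R →ₐ[K] K} (hχ : ∀ (r : R) (m : S), r • m = χ r • m) (c : N) :
    koszulRankOne e l c = 0 ↔
      ∃ z : Fin n → N, c = ∑ i, (coord e i - algebraMap K R (χ (coord e i))) • z i := by
  have hcomm (i : Fin n) (z : S →ₗ[K] N) (m : S) :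
      (coordMul e i N ∘ₗ z - z ∘ₗ coordMul e i S) m =
        (coord e i - algebraMap K R (χ (coord e i))) • z m := by
    rw [sub_smul, algebraMap_smul, ← z.map_smul, ← hχ]
    rfl
  refine (koszul_eq_zero_iff e (l.smulRight c)).trans ⟨?_, ?_⟩
  · rintro ⟨z, hz⟩
    refine ⟨fun i => z i s, ?_⟩
    have := LinearMap.congr_fun hz s
    rw [LinearMap.smulRight_apply, hl, one_smul, LinearMap.sum_apply] at this
    exact this.trans (Finset.sum_congr rfl fun i _ => hcomm i (z i) s)
  · rintro ⟨z, hz⟩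
    refine ⟨fun i => l.smulRight (z i), ?_⟩
    ext m
    rw [LinearMap.sum_apply, LinearMap.smulRight_apply, hz, Finset.smul_sum]
    refine Finset.sum_congr rfl fun i _ => Eq.trans ?_ (hcomm i _ m).symm
    exact smul_comm _ _ _

lemma ofOp_tr_smul (S : ModuleCat.{u} R) (r : R) (x : Ext S (regular R) n) :
    (HSMul.hSMul (α := R) (β := ofOp (tr n S)) r x : ofOp (tr n S)) =
      x.comp (Ext.mk₀ (mulRight r)) (add_zero n) := rfl

/-- The map `R → Ext^n(S, R)` given by a functional `S → K`. -/
noncomputable def extOfFunctional {S : ModuleCat.{u} R} (l : S →ₗ[K] K) :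
    R →ₗ[R] ofOp (tr n S) where
  toFun c := (koszulRankOne e l (c : regular R) : Ext S (regular R) n)
  map_add' c d := map_add (koszulRankOne e l : regular R →+ Ext S (regular R) n) c d
  map_smul' r c := by
    rw [RingHom.id_apply, ofOp_tr_smul, koszulRankOne_comp_mk₀]
    exact congrArg (koszulRankOne e l) (mul_comm r c)

lemma extOfFunctional_eq_zero_iff {S : ModuleCat.{u} R} (l : S →ₗ[K] K) (c : R) :
    extOfFunctional e l c = 0 ↔ (koszulRankOne e l (c : regular R) : Ext S (regular R) n) = 0 :=
  Iff.rfl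

lemma exists_sum_regular_iff (y : Fin n → R) (c : R) :
    (∃ z : Fin n → regular R, (c : regular R) = ∑ i, y i • z i) ↔ c ∈ Ideal.span (Set.range y) := by
  rw [Ideal.mem_span_range_iff_exists_fun]
  refine exists_congr fun z => ⟨fun h => ?_, fun h => ?_⟩
  · exact (Finset.sum_congr rfl fun i _ => mul_comm _ _).trans h.symm
  · exact h.symm.trans (Finset.sum_congr rfl fun i _ => mul_comm _ _)

include e in
/-- `tr^n(S) ≅ S` for simple modules. -/
theorem tr_simple_equiv [IsAlgClosed K] (S : ModuleCat.{u} R) [IsSimpleModule R S] :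
    Nonempty (ofOp (tr n S) ≃ₗ[R] S) := by
  have : Algebra.FiniteType K R := .equiv inferInstance e
  obtain ⟨χ, hχ⟩ := exists_character (K := K) S
  obtain ⟨s, l, hl, hs⟩ := exists_generator S hχ
  have hs0 : s ≠ 0 := fun h => by simp [h] at hl
  have hsurj : Function.Surjective (extOfFunctional e l) := koszulRankOne_surjective e hs
  have hsurj' : Function.Surjective (LinearMap.toSpanSingleton R S s) := fun m =>
    ⟨algebraMap K R (l m), (algebraMap_smul R (l m) s).trans (hs m).symm⟩
  -- Both `tr^n(S)` and `S` are cyclic, and both kernels are the maximal ideal `ker χ`, generated by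
  -- the shifted coordinates.
  have hker : LinearMap.ker (extOfFunctional e l) =
      LinearMap.ker (LinearMap.toSpanSingleton R S s) := by
    ext c
    rw [LinearMap.mem_ker, LinearMap.mem_ker, LinearMap.toSpanSingleton_apply, hχ,
      smul_eq_zero_iff_left hs0, extOfFunctional_eq_zero_iff, koszulRankOne_eq_zero_iff e hl hχ,
      exists_sum_regular_iff]
    refine ⟨fun hc => ?_, fun hc => by simpa [hc] using sub_character_mem e χ c⟩
    have : Ideal.span (Set.range fun i => coord e i - algebraMap K R (χ (coord e i))) ≤
        RingHom.ker χ := Ideal.span_le.mpr (by rintro _ ⟨i, rfl⟩; simp)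
    exact this hc
  exact ⟨((LinearMap.quotKerEquivOfSurjective _ hsurj).symm.trans
    (Submodule.quotEquivOfEq _ _ hker)).trans (LinearMap.quotKerEquivOfSurjective _ hsurj')⟩

end Simple

/-! ### Resolutions by finitely generated projectives over a Noetherian ring -/

section FiniteResolution

variable {R : Type u} [CommRing R] [IsNoetherianRing R]

lemma fg_epi_of_surjective {M N : FGModuleCat.{u} R} (f : M ⟶ N)
    (h : Function.Surjective f.hom.hom) : Epi f := by
  have : Epi ((forget₂ (FGModuleCat.{u} R) (ModuleCat.{u} R)).map f) :=
    (ModuleCat.epi_iff_surjective _).mpr h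
  exact (forget₂ (FGModuleCat.{u} R) (ModuleCat.{u} R)).epi_of_epi_map this

lemma fg_projective_of_projective (M : FGModuleCat.{u} R) [Module.Projective R M] :
    Projective M where
  factors {E F} f p hp := by
    have : Epi ((forget₂ (FGModuleCat.{u} R) (ModuleCat.{u} R)).map p) := inferInstance
    obtain ⟨g, hg⟩ := Module.projective_lifting_property p.hom.hom f.hom.hom
      ((ModuleCat.epi_iff_surjective _).mp this)
    exact ⟨FGModuleCat.ofHom g, FGModuleCat.hom_ext hg⟩

lemma fg_exists_free_cover (M : FGModuleCat.{u} R) :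
    ∃ (k : ℕ) (f : FGModuleCat.of R (Fin k → R) ⟶ M), Epi f := by
  obtain ⟨k, f, hf⟩ := Module.Finite.exists_fin' R M
  exact ⟨k, FGModuleCat.ofHom f, fg_epi_of_surjective _ hf⟩

instance : EnoughProjectives (FGModuleCat.{u} R) where
  presentation M := by
    obtain ⟨k, f, hf⟩ := fg_exists_free_cover M
    exact ⟨{ p := _, projective := fg_projective_of_projective _, f := f, epi := hf }⟩

/-- A projective object of `FGModuleCat` is a retract of a finite free module, and functors preserve
retracts. Resolutions built inside `FGModuleCat` therefore stay projective in `ModuleCat`. -/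
instance : (forget₂ (FGModuleCat.{u} R) (ModuleCat.{u} R)).PreservesProjectiveObjects where
  projective_obj {P} hP := by
    obtain ⟨k, f, hf⟩ := fg_exists_free_cover P
    let s := Projective.factorThru (𝟙 P) f
    have hs : s ≫ f = 𝟙 P := Projective.factorThru_comp _ _
    let F := forget₂ (FGModuleCat.{u} R) (ModuleCat.{u} R)
    have : Projective (F.obj (FGModuleCat.of R (Fin k → R))) :=
      (IsProjective.iff_projective (R := R) (Fin k → R)).mp inferInstance
    exact (Retract.mk (F.map s) (F.map f) (by rw [← F.map_comp, hs, F.map_id])).projective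

lemma exists_finite_resolution (M : ModuleCat.{u} R) [Module.Finite R M] :
    ∃ P : ProjectiveResolution M, ∀ i : ℕ, Module.Finite R (P.complex.X i) := by
  let F := forget₂ (FGModuleCat.{u} R) (ModuleCat.{u} R)
  let P := projectiveResolution (FGModuleCat.of R M)
  exact ⟨F.mapProjectiveResolution P, fun i =>
    inferInstanceAs (Module.Finite R (P.complex.X i))⟩

omit [IsNoetherianRing R] in
lemma finite_of_finite_resolution {M : ModuleCat.{u} R}
    (h : ∃ P : ProjectiveResolution M, ∀ i : ℕ, Module.Finite R (P.complex.X i)) :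
    Module.Finite R M := by
  obtain ⟨P, hP⟩ := h
  have hepi : Epi (P.π.f 0) := inferInstance
  have := hP 0
  exact Module.Finite.of_surjective (P.π.f 0).hom ((ModuleCat.epi_iff_surjective _).mp hepi)

end FiniteResolution

/-! ### `H^n` consists of the modules of finite length -/

section FiniteLength

variable {K R : Type u} [Field K] [CommRing R] [Algebra K R] {n : ℕ}
  (e : MvPolynomial (Fin n) K ≃ₐ[K] R)

/-- The short exact sequence of a submodule. -/
lemma submodule_shortExact (M : ModuleCat.{u} R) (N : Submodule R M) :
    (ShortComplex.mk (ModuleCat.ofHom N.subtype) (ModuleCat.ofHom N.mkQ) (by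
      ext x; simp) : ShortComplex (ModuleCat.{u} R)).ShortExact where
  exact := by
    rw [ShortComplex.moduleCat_exact_iff]
    intro x hx
    exact ⟨⟨x, (Submodule.Quotient.mk_eq_zero N).mp hx⟩, rfl⟩
  mono_f := (ModuleCat.mono_iff_injective _).mpr N.subtype_injective
  epi_g := (ModuleCat.epi_iff_surjective _).mpr N.mkQ_surjective

include e in
lemma ext_subsingleton_of_finiteLength [IsAlgClosed K] {M : Type u} [AddCommGroup M] [Module R M]
    (hM : IsFiniteLength R M) {i : ℕ} (hi : i < n) :
    Subsingleton (Ext (ModuleCat.of R M) (regular R) i) := by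
  induction hM with
  | @of_subsingleton M _ _ _ =>
    have h : Limits.IsZero (ModuleCat.of R M) := ModuleCat.isZero_of_subsingleton _
    exact h.hasProjectiveDimensionLT_zero.subsingleton _ 0 i (Nat.zero_le i) _
  | @of_simple_quotient M _ _ N _ hN ih =>
    refine subsingleton_of_forall_eq 0 fun x => ?_
    have hS := submodule_shortExact (ModuleCat.of R M) N
    obtain ⟨y, rfl⟩ := Ext.contravariant_sequence_exact₂ hS _ x (ih.elim _ _)
    have : Subsingleton (Ext (ModuleCat.of R (M ⧸ N)) (regular R) i) :=
      ext_simple_subsingleton e _ hi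
    rw [this.elim y 0]
    exact Ext.comp_zero _ _ _ _ _

include e in
lemma ext_simple_nontrivial [IsAlgClosed K] (S : ModuleCat.{u} R) [IsSimpleModule R S] :
    ∃ x : Ext S (regular R) n, x ≠ 0 := by
  obtain ⟨f⟩ := tr_simple_equiv e S
  have := IsSimpleModule.nontrivial R S
  have : Nontrivial (ofOp (tr n S)) := f.toEquiv.nontrivial
  exact exists_ne (0 : ofOp (tr n S))

include e in
-- For a simple quotient `M/N`, the map from `Ext^n(M/N, R)` to `Ext^n(M, R)` is injective, because
-- `Ext^(n-1)(N, R)` vanishes.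
lemma ext_ne_zero_of_finiteLength [IsAlgClosed K] (hn : 0 < n) {M : Type u} [AddCommGroup M]
    [Module R M] [Nontrivial M] (hM : IsFiniteLength R M) :
    ∃ x : Ext (ModuleCat.of R M) (regular R) n, x ≠ 0 := by
  cases hM with
  | of_subsingleton => exact (not_subsingleton M ‹_›).elim
  | @of_simple_quotient _ _ _ N _ hN =>
    obtain ⟨x, hx⟩ := ext_simple_nontrivial e (ModuleCat.of R (M ⧸ N))
    have hS := submodule_shortExact (ModuleCat.of R M) N
    refine ⟨(Ext.mk₀ (ModuleCat.ofHom N.mkQ)).comp x (zero_add n), fun h => hx ?_⟩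
    -- Positivity of `n` is needed here: `n - 1` is a genuine predecessor.
    obtain ⟨y, rfl⟩ := Ext.contravariant_sequence_exact₃ hS _ x h (n₀ := n - 1) (by lia)
    have : Subsingleton (Ext (ModuleCat.of R N) (regular R) (n - 1)) :=
      ext_subsingleton_of_finiteLength e hN (by lia)
    rw [this.elim y 0]
    exact Ext.comp_zero _ _ _ _ _

include e in
lemma hasProjectiveDimensionLE (M : ModuleCat.{u} R) : HasProjectiveDimensionLE M n :=
  .mk fun _ hi _ y => ext_eq_zero_of_lt e _ _ hi y

include e in
lemma projectiveDimension_le (M : ModuleCat.{u} R) : projectiveDimension M ≤ n :=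
  (projectiveDimension_le_iff M n).mpr (hasProjectiveDimensionLE e M)

include e in
lemma projectiveDimension_eq_of_finiteLength [IsAlgClosed K] (hn : 0 < n) (M : ModuleCat.{u} R)
    [Nontrivial M] (hM : IsFiniteLength R M) : projectiveDimension M = n := by
  refine le_antisymm (projectiveDimension_le e M) ?_
  rw [projectiveDimension_ge_iff]
  intro h
  obtain ⟨x, hx⟩ := ext_ne_zero_of_finiteLength e hn hM
  exact hx ((h.subsingleton M n n le_rfl _).elim _ _)

include e in
lemma memH_of_finiteLength [IsAlgClosed K] (hn : 0 < n) (M : ModuleCat.{u} R)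
    (hM : IsFiniteLength R M) : MemH n M := by
  have : IsNoetherianRing R := isNoetherianRing_of_ringEquiv _ e.toRingEquiv
  have := (isFiniteLength_iff_isNoetherian_isArtinian.mp hM).1
  refine ⟨?_, fun i hi => ?_, exists_finite_resolution M⟩
  · cases subsingleton_or_nontrivial M
    · exact Or.inl (ModuleCat.isZero_of_subsingleton _)
    · exact Or.inr (projectiveDimension_eq_of_finiteLength e hn M hM)
  · rcases lt_or_gt_of_ne hi with h | h
    · exact ext_subsingleton_of_finiteLength e hM h
    · exact subsingleton_of_forall_eq 0 fun x => ext_eq_zero_of_lt e _ _ h x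

/-- An element regular on a module avoids the minimal primes over its annihilator, so each member of
the sequence lowers the dimension of the support by at least one. -/
lemma supportDim_quotient_add_length_le {A : Type u} [CommRing A] (M : Type u) [AddCommGroup M]
    [Module A M] [Module.Finite A M] (rs : List A)
    (h : RingTheory.Sequence.IsWeaklyRegular M rs) :
    Module.supportDim A (M ⧸ Ideal.ofList rs • (⊤ : Submodule A M)) + rs.length ≤
      Module.supportDim A M := by
  induction rs generalizing M with
  | nil =>
    rw [Ideal.ofList_nil, Submodule.bot_smul]
    simpa using (Module.supportDim_eq_of_equiv (Submodule.quotEquivOfEqBot ⊥ rfl)).le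
  | cons x rs ih =>
    obtain ⟨hx, hrs⟩ := (RingTheory.Sequence.isWeaklyRegular_cons_iff M x rs).mp h
    rw [Module.supportDim_eq_of_equiv (Submodule.quotOfListConsSMulTopEquivQuotSMulTopInner M x rs)]
    refine le_trans ?_ (Module.supportDim_quotSMulTop_succ_le_of_notMem_minimalPrimes
      fun _ => hx.notMem_of_mem_minimalPrimes)
    simpa [add_assoc] using add_le_add_left (ih _ hrs) 1

include e in
-- The converse form of Rees' theorem gives an `R`-regular sequence of length `n` inside `ann M`. As
-- `dim R = n`, the quotient `R/ann M` has dimension at most zero and is Artinian; `M` is finitely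
-- generated over it.
lemma finiteLength_of_memH (M : ModuleCat.{u} R) (hM : MemH n M) : IsFiniteLength R M := by
  have : IsNoetherianRing R := isNoetherianRing_of_ringEquiv _ e.toRingEquiv
  have := isDomain_of_algEquiv e
  have := finite_of_finite_resolution hM.2.2
  cases subsingleton_or_nontrivial M
  · exact .of_subsingleton
  have hann : Module.annihilator R M ≠ ⊤ := fun h =>
    not_subsingleton M (Module.annihilator_eq_top_iff.mp h)
  obtain ⟨rs, hlen, hmem, hreg⟩ := ModuleCat.exists_isRegular_of_exists_subsingleton_ext
    (Module.annihilator R M) n (regular R) (by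
      rw [lt_top_iff_ne_top, smul_eq_mul, Ideal.mul_top]; exact hann) M
    Module.support_eq_zeroLocus fun i hi => hM.2.1 i hi.ne
  have hdim : ringKrullDim R = n := by
    rw [ringKrullDim_eq_of_ringEquiv e.symm.toRingEquiv]
    simp
  have hle := supportDim_quotient_add_length_le (R : Type u) rs hreg.1
  rw [Module.supportDim_self_eq_ringKrullDim, hdim, hlen, smul_eq_mul, Ideal.mul_top,
    Module.supportDim_quotient_eq_ringKrullDim] at hle
  have hle' : ringKrullDim (R ⧸ Module.annihilator R M) + n ≤ n := le_trans (by
    gcongr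
    exact ringKrullDim_le_of_surjective (Ideal.Quotient.factor (Ideal.span_le.mpr hmem))
      (Ideal.Quotient.factor_surjective _)) hle
  -- Cancelling `n` requires separating the values `⊥` and `⊤` of the dimension.
  have hzero : ringKrullDim (R ⧸ Module.annihilator R M) ≤ 0 := by
    generalize ringKrullDim (R ⧸ Module.annihilator R M) = d at hle'
    induction d with
    | bot => exact bot_le
    | coe d =>
      norm_cast at hle' ⊢
      cases d with
      | top => exact absurd hle' (by simp)
      | coe d =>
        norm_cast at hle' ⊢
        lia
  have : Ring.KrullDimLE 0 (R ⧸ Module.annihilator R M) := Ring.krullDimLE_iff.mpr hzero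
  have : IsArtinianRing (R ⧸ Module.annihilator R M) :=
    isArtinianRing_iff_krullDimLE_zero.mpr inferInstance
  let : Module (R ⧸ Module.annihilator R M) M := Module.quotientAnnihilator
  have : IsScalarTower R (R ⧸ Module.annihilator R M) M := .of_algebraMap_smul fun _ _ => rfl
  have : Module.Finite (R ⧸ Module.annihilator R M) M := .of_restrictScalars_finite R _ _
  refine isFiniteLength_iff_isNoetherian_isArtinian.mpr ⟨inferInstance, ?_⟩
  exact isArtinian_of_surjective_algebraMap (R := R ⧸ Module.annihilator R M)
    Ideal.Quotient.mk_surjective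

end FiniteLength

/-! ### Trace duality between commutators and intertwiners -/

section TraceDuality

variable {K C X : Type u} [Field K] [AddCommGroup C] [Module K C] [AddCommGroup X] [Module K X]
  [FiniteDimensional K C]

omit [FiniteDimensional K C] in
lemma linearMap_sum_comp {Y : Type u} [AddCommGroup Y] [Module K Y] {ι : Type} [Fintype ι]
    (z : ι → X →ₗ[K] C) (g : Y →ₗ[K] X) : (∑ i, z i) ∘ₗ g = ∑ i, z i ∘ₗ g := by
  ext x
  simp [LinearMap.sum_apply]

lemma eq_zero_of_trace_comp {ω : X →ₗ[K] C}
    (h : ∀ g : C →ₗ[K] X, LinearMap.trace K C (ω ∘ₗ g) = 0) : ω = 0 := by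
  ext x
  refine (Module.forall_dual_apply_eq_zero_iff K (ω x)).mp fun f => ?_
  rw [← LinearMap.trace_smulRight, ← h (f.smulRight x)]
  congr 1
  ext
  simp

/-- With a basis `b` of `C`, every `g` is a sum of rank-one maps, and the trace of a rank-one
endomorphism is an evaluation. Finite dimension is needed only for `C`. -/
lemma exists_trace_comp_eq (μ : (C →ₗ[K] X) →ₗ[K] K) :
    ∃ ω : X →ₗ[K] C, ∀ g, μ g = LinearMap.trace K C (ω ∘ₗ g) := by
  let b := Module.finBasis K C
  refine ⟨∑ j, (μ ∘ₗ (LinearMap.smulRightₗ (b.coord j))).smulRight (b j), fun g => ?_⟩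
  have hg : g = ∑ j, (b.coord j).smulRight (g (b j)) := by
    refine b.ext fun i => ?_
    simp [LinearMap.sum_apply, Finsupp.single_apply]
  conv_lhs => rw [hg, map_sum]
  conv_rhs => rw [linearMap_sum_comp, map_sum]
  refine Finset.sum_congr rfl fun j _ => ?_
  exact (LinearMap.trace_smulRight
    ((μ ∘ₗ LinearMap.smulRightₗ (b.coord j)) ∘ₗ g) (b j)).symm

variable {ι : Type} [Fintype ι] (c : ι → C →ₗ[K] C) (y : ι → X →ₗ[K] X)

/-- The functional `g ↦ tr(ω g)` vanishes on the kernel of `g ↦ (y_i g - g c_i)_i`, so it factors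
through this map. Each component of the factorization is again a trace functional, and cyclicity of
the trace rewrites the result as commutators. -/
lemma exists_eq_sum_commutator_left {ω : X →ₗ[K] C}
    (hω : ∀ g : C →ₗ[K] X, (∀ i, y i ∘ₗ g = g ∘ₗ c i) → LinearMap.trace K C (ω ∘ₗ g) = 0) :
    ∃ z : ι → X →ₗ[K] C, ω = ∑ i, (c i ∘ₗ z i - z i ∘ₗ y i) := by
  classical
  let ad : (C →ₗ[K] X) →ₗ[K] (ι → C →ₗ[K] X) :=
    LinearMap.pi fun i => LinearMap.llcomp K C X X (y i) - LinearMap.lcomp K X (c i)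
  have had (g : C →ₗ[K] X) (i : ι) : ad g i = y i ∘ₗ g - g ∘ₗ c i := rfl
  let τ : (C →ₗ[K] X) →ₗ[K] K := LinearMap.trace K C ∘ₗ LinearMap.llcomp K C X C ω
  obtain ⟨μ, hμ⟩ : ∃ μ : (ι → C →ₗ[K] X) →ₗ[K] K, μ ∘ₗ ad = τ := by
    have : τ ∈ LinearMap.range ad.dualMap := by
      rw [LinearMap.range_dualMap_eq_dualAnnihilator_ker, Submodule.mem_dualAnnihilator]
      intro g hg
      refine hω g fun i => sub_eq_zero.mp ?_
      rw [← had, LinearMap.mem_ker.mp hg, Pi.zero_apply]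
    exact this
  choose z hz using fun i => exists_trace_comp_eq (μ ∘ₗ LinearMap.single K (fun _ => C →ₗ[K] X) i)
  -- The sign comes from `tr(z (y g - g c)) = tr((z y - c z) g)`.
  refine ⟨fun i => - z i, ?_⟩
  rw [← sub_eq_zero]
  refine eq_zero_of_trace_comp fun g => ?_
  have h1 : LinearMap.trace K C (ω ∘ₗ g) =
      ∑ i, LinearMap.trace K C (z i ∘ₗ (y i ∘ₗ g - g ∘ₗ c i)) := by
    refine (LinearMap.congr_fun hμ g).symm.trans ?_
    rw [LinearMap.comp_apply, ← LinearMap.sum_single_apply (fun _ => C →ₗ[K] X) (ad g), map_sum]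
    exact Finset.sum_congr rfl fun i _ => hz i _
  rw [LinearMap.sub_comp, map_sub, h1, linearMap_sum_comp, map_sum, ← Finset.sum_sub_distrib]
  refine Finset.sum_eq_zero fun i _ => ?_
  have := LinearMap.trace_mul_comm K (c i) (z i ∘ₗ g)
  simp only [Module.End.mul_eq_comp] at this
  simp only [LinearMap.comp_sub, LinearMap.sub_comp, LinearMap.comp_neg, LinearMap.neg_comp,
    map_sub, map_neg, LinearMap.comp_assoc] at this ⊢
  rw [this]
  ring

/-- Otherwise some functional kills all commutators but not `ω`. It is a trace against some `g : X →
C`, and vanishing on commutators forces `g` to intertwine the actions, contrary to the hypothesis.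
-/
lemma exists_eq_sum_commutator_right {ω : C →ₗ[K] X}
    (hω : ∀ g : X →ₗ[K] C, (∀ i, c i ∘ₗ g = g ∘ₗ y i) → LinearMap.trace K C (g ∘ₗ ω) = 0) :
    ∃ z : ι → C →ₗ[K] X, ω = ∑ i, (y i ∘ₗ z i - z i ∘ₗ c i) := by
  let ad : (ι → C →ₗ[K] X) →ₗ[K] (C →ₗ[K] X) :=
    ∑ i, (LinearMap.llcomp K C X X (y i) - LinearMap.lcomp K X (c i)) ∘ₗ LinearMap.proj i
  have had (z : ι → C →ₗ[K] X) : ad z = ∑ i, (y i ∘ₗ z i - z i ∘ₗ c i) := by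
    simp [ad, LinearMap.sum_apply]
    rfl
  suffices ω ∈ LinearMap.range ad by
    obtain ⟨z, hz⟩ := this
    exact ⟨z, hz.symm.trans (had z)⟩
  by_contra hmem
  obtain ⟨μ, hμ, hle⟩ := Submodule.exists_le_ker_of_notMem hmem
  obtain ⟨g, hg⟩ := exists_trace_comp_eq μ
  refine hμ ((hg ω).trans (hω g fun i => sub_eq_zero.mp (eq_zero_of_trace_comp fun z => ?_)))
  have h0 : μ (y i ∘ₗ z - z ∘ₗ c i) = 0 := by
    classical
    refine (congrArg μ ?_).trans (hle (LinearMap.mem_range_self ad (Pi.single i z)))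
    rw [had, Finset.sum_eq_single i]
    · simp
    · intro j _ hj
      simp [Pi.single_eq_of_ne hj]
    · simp
  rw [hg] at h0
  have := LinearMap.trace_mul_comm K (c i) (g ∘ₗ z)
  simp only [Module.End.mul_eq_comp] at this
  simp only [LinearMap.comp_sub, LinearMap.sub_comp, map_sub, LinearMap.comp_assoc] at this h0 ⊢
  rw [this, ← neg_sub, h0, neg_zero]

end TraceDuality

/-! ### Fitting's lemma and local endomorphism rings -/

section LocalEndomorphisms

variable {R : Type u} [Ring R]

lemma indecomposable_isCompl {C : ModuleCat.{u} R} (hC : Indecomposable C) {p q : Submodule R C}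
    (h : IsCompl p q) : p = ⊥ ∨ q = ⊥ := by
  have i : C ≅ ModuleCat.of R p ⊞ ModuleCat.of R q :=
    (Submodule.prodEquivOfIsCompl p q h).symm.toModuleIso ≪≫
      (ModuleCat.biprodIsoProd (ModuleCat.of R p) (ModuleCat.of R q)).symm
  refine (hC.2 _ _ i).imp (fun h => ?_) fun h => ?_
  all_goals
    have := ModuleCat.subsingleton_of_isZero h
    exact Submodule.subsingleton_iff_eq_bot.mp this

/-- Fitting: for a high power of `f`, the kernel and the range are complementary, so one of them is
zero. -/
lemma indecomposable_isNilpotent {C : ModuleCat.{u} R} (hC : Indecomposable C)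
    (hfl : IsFiniteLength R C) {f : Module.End R C} (hf : ¬ IsUnit f) : IsNilpotent f := by
  obtain ⟨h1, h2⟩ := isFiniteLength_iff_isNoetherian_isArtinian.mp hfl
  obtain ⟨k, hk⟩ := Filter.eventually_atTop.mp f.eventually_isCompl_ker_pow_range_pow
  have hcompl := hk (k + 1) (Nat.le_succ k)
  refine ⟨k + 1, ?_⟩
  rcases indecomposable_isCompl hC hcompl with h | h
  · refine absurd ?_ hf
    have hr : LinearMap.range (f ^ (k + 1)) = ⊤ := by
      simpa [h] using hcompl.sup_eq_top
    have hu : IsUnit (f ^ (k + 1)) :=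
      (Module.End.isUnit_iff _).mpr ⟨LinearMap.ker_eq_bot.mp h, LinearMap.range_eq_top.mp hr⟩
    exact (isUnit_pow_succ_iff).mp hu
  · exact LinearMap.range_eq_bot.mp h

/-- If `w = f + g` were a unit, `w⁻¹ f` would be nilpotent, making `w⁻¹ g = 1 - w⁻¹ f` a unit. -/
lemma not_isUnit_add {C : ModuleCat.{u} R} (hC : Indecomposable C)
    (hfl : IsFiniteLength R C) {f g : Module.End R C} (hf : ¬ IsUnit f) (hg : ¬ IsUnit g) :
    ¬ IsUnit (f + g) := by
  rintro ⟨w, hw⟩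
  have h1 : ¬ IsUnit (↑w⁻¹ * f) := by simpa using hf
  have h2 : ↑w⁻¹ * g = 1 - ↑w⁻¹ * f := by
    rw [eq_sub_iff_add_eq, add_comm, ← mul_add, ← hw, Units.inv_mul]
  have := (indecomposable_isNilpotent hC hfl h1).isUnit_one_sub
  rw [← h2] at this
  exact hg (by simpa using this)

end LocalEndomorphisms

/-! ### Almost split classes from the trace form -/

section AlmostSplit

open scoped ModuleCat

variable {K R : Type u} [Field K] [CommRing R] [Algebra K R] {n : ℕ}
  (e : MvPolynomial (Fin n) K ≃ₐ[K] R)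

include e in
lemma finite_of_isSimpleModule [IsAlgClosed K] (S : Type u) [AddCommGroup S] [Module R S]
    [Module K S] [IsScalarTower K R S] [IsSimpleModule R S] : Module.Finite K S := by
  have : Algebra.FiniteType K R := .equiv inferInstance e
  obtain ⟨I, hI, ⟨f⟩⟩ := isSimpleModule_iff_quot_maximal.mp ‹IsSimpleModule R S›
  let : Field (R ⧸ I) := Ideal.Quotient.field I
  have : Module.Finite K (R ⧸ I) := finite_of_finite_type_of_isJacobsonRing K (R ⧸ I)
  exact Module.Finite.equiv (f.restrictScalars K).symm

include e in
lemma finite_of_isFiniteLength [IsAlgClosed K] {M : Type u} [AddCommGroup M] [Module R M]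
    (hM : IsFiniteLength R M) : ∀ [Module K M] [IsScalarTower K R M], Module.Finite K M := by
  induction hM with
  | of_subsingleton =>
    intro _ _
    infer_instance
  | @of_simple_quotient M _ _ N _ hN ih =>
    intro _ _
    have h1 : Module.Finite K (N.restrictScalars K) := ih
    have h3 : Module.Finite K (M ⧸ N) := finite_of_isSimpleModule e _
    have h2 : Module.Finite K (M ⧸ N.restrictScalars K) := h3
    exact Module.Finite.of_submodule_quotient (N.restrictScalars K)

/-- A functional on the endomorphism ring that detects units. -/
lemma exists_functional {C : ModuleCat.{u} R} (hC : Indecomposable C)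
    (hfl : IsFiniteLength R C) :
    ∃ l : Module.End R C →ₗ[K] K, l 1 = 1 ∧ ∀ f, ¬ IsUnit f → l f = 0 := by
  have : Nontrivial C := by
    by_contra h
    rw [not_nontrivial_iff_subsingleton] at h
    exact hC.1 (ModuleCat.isZero_of_subsingleton C)
  let N : Submodule K (Module.End R C) :=
    { carrier := {f | ¬ IsUnit f}
      add_mem' := not_isUnit_add hC hfl
      zero_mem' := not_isUnit_zero
      smul_mem' := fun a f hf => by
        by_cases ha : a = 0
        · rw [ha, zero_smul]
          exact not_isUnit_zero
        · intro h
          refine hf ?_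
          simpa [Units.smul_def, ha] using h.smul (Units.mk0 a ha)⁻¹ }
  -- The non-units form a proper `K`-subspace because the endomorphism ring is local, so a
  -- functional separates `1` from them.
  obtain ⟨l, hl, hN⟩ := Submodule.exists_le_ker_of_notMem (p := N) (v := 1) fun h => h isUnit_one
  refine ⟨(l 1)⁻¹ • l, ?_, fun f hf => ?_⟩
  · simp [hl]
  · simp [show l f = 0 from hN hf]

lemma smul_comm_of_coordMul {M N : ModuleCat.{u} R} {g : M →ₗ[K] N}
    (hg : ∀ i, coordMul e i N ∘ₗ g = g ∘ₗ coordMul e i M) (r : R) (m : M) :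
    g (r • m) = r • g m :=
  smul_comm_of_coord (e := e) (g := g.toAddMonoidHom)
    (fun a m => by simp) (fun i m => (LinearMap.congr_fun (hg i) m).symm) r m

/-- The map `φ` represents, under the trace form, the functional that detects units of `End_R(C)`.
If `f : X → C` is not a split epimorphism, no composite `C → X → C` ending in `f` is a unit, so `φ
f` is orthogonal to all `R`-linear `C → X` and is a sum of commutators. Split monomorphisms are
dual. -/
theorem exists_almostSplit_endomorphism [IsAlgClosed K] {C : ModuleCat.{u} R}
    (hC : Indecomposable C) (hfl : IsFiniteLength R C) :
    ∃ φ : C →ₗ[K] C,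
      (¬ ∃ z : Fin n → C →ₗ[K] C, φ = ∑ i, (coordMul e i C ∘ₗ z i - z i ∘ₗ coordMul e i C)) ∧
      (∀ (X : ModuleCat.{u} R) (f : X ⟶ C), ¬ IsSplitEpi f → ∃ z : Fin n → X →ₗ[K] C,
        φ ∘ₗ f.hom.restrictScalars K =
          ∑ i, (coordMul e i C ∘ₗ z i - z i ∘ₗ coordMul e i X)) ∧
      (∀ (Y : ModuleCat.{u} R) (g : C ⟶ Y), ¬ IsSplitMono g → ∃ z : Fin n → C →ₗ[K] Y,
        g.hom.restrictScalars K ∘ₗ φ =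
          ∑ i, (coordMul e i Y ∘ₗ z i - z i ∘ₗ coordMul e i C)) := by
  have : FiniteDimensional K C := finite_of_isFiniteLength e hfl
  obtain ⟨l, hl1, hl⟩ := exists_functional (K := K) hC hfl
  let ρ : Module.End R C →ₗ[K] (C →ₗ[K] C) := LinearMap.restrictScalarsₗ K R C C K
  -- The retraction `s` extends `l` from `R`-linear to all `K`-linear endomorphisms, where trace
  -- duality applies.
  obtain ⟨s, hs⟩ := ρ.exists_leftInverse_of_injective
    (LinearMap.ker_eq_bot.mpr (LinearMap.restrictScalars_injective K))
  obtain ⟨φ, hφ⟩ := exists_trace_comp_eq (l ∘ₗ s)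
  have key (f : C ⟶ C) : LinearMap.trace K C (φ ∘ₗ f.hom.restrictScalars K) = l f.hom := by
    rw [← hφ]
    exact congrArg l (LinearMap.congr_fun hs f.hom)
  have hcomm (a b : C →ₗ[K] C) : LinearMap.trace K C (a ∘ₗ b) = LinearMap.trace K C (b ∘ₗ a) :=
    LinearMap.trace_mul_comm K a b
  refine ⟨φ, ?_, fun X f hf => ?_, fun Y g hg => ?_⟩
  -- A sum of commutators of endomorphisms has trace zero, whereas `tr φ = l 1 = 1`.
  · rintro ⟨z, hz⟩
    have h1 := key (𝟙 C)
    rw [ModuleCat.hom_id] at h1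
    have h2 : l LinearMap.id = 1 := hl1
    rw [h2, hz] at h1
    refine zero_ne_one (h1.symm.trans ?_).symm
    change LinearMap.trace K C (∑ i, (coordMul e i C ∘ₗ z i - z i ∘ₗ coordMul e i C)) = 0
    rw [map_sum]
    refine Finset.sum_eq_zero fun i _ => ?_
    rw [map_sub, hcomm, sub_self]
  · refine exists_eq_sum_commutator_left _ _ fun h hh => ?_
    let h' : C ⟶ X := ModuleCat.ofHom { h with map_smul' := smul_comm_of_coordMul e hh }
    refine (key (h' ≫ f)).trans (hl _ fun hu => hf ?_)
    obtain ⟨v, hv⟩ := hu.exists_right_inv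
    exact ⟨⟨⟨ModuleCat.ofHom v ≫ h', by ext x; exact LinearMap.congr_fun hv x⟩⟩⟩
  · refine exists_eq_sum_commutator_right _ _ fun h hh => ?_
    let h' : Y ⟶ C := ModuleCat.ofHom { h with map_smul' := smul_comm_of_coordMul e hh }
    refine (hcomm (h ∘ₗ g.hom.restrictScalars K) φ).trans
      ((key (g ≫ h')).trans (hl _ fun hu => hg ?_))
    obtain ⟨v, hv⟩ := hu.exists_left_inv
    exact ⟨⟨⟨h' ≫ ModuleCat.ofHom v, by ext x; exact LinearMap.congr_fun hv x⟩⟩⟩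

end AlmostSplit

section AlmostSplitClass

open scoped ModuleCat

variable {K R : Type u} [Field K] [CommRing R] [Algebra K R] {n : ℕ}
  (e : MvPolynomial (Fin n) K ≃ₐ[K] R)

include e in
theorem exists_almostSplit_class [IsAlgClosed K] {C : ModuleCat.{u} R}
    (hC : Indecomposable C) (hfl : IsFiniteLength R C) :
    ∃ η : Ext C C n, η ≠ 0 ∧
      (∀ (X : ModuleCat.{u} R) (f : X ⟶ C), ¬ IsSplitEpi f →
        (Ext.mk₀ f).comp η (zero_add n) = 0) ∧
      (∀ (Y : ModuleCat.{u} R) (g : C ⟶ Y), ¬ IsSplitMono g →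
        η.comp (Ext.mk₀ g) (add_zero n) = 0) := by
  obtain ⟨φ, h0, hl, hr⟩ := exists_almostSplit_endomorphism e hC hfl
  refine ⟨koszul e φ, fun h => h0 ((koszul_eq_zero_iff e φ).mp h), fun X f hf => ?_,
    fun Y g hg => ?_⟩
  · rw [mk₀_comp_koszul e f φ (g' := φ ∘ₗ f.hom.restrictScalars K) fun m => rfl]
    exact (koszul_eq_zero_iff e _).mpr (hl X f hf)
  · rw [koszul_comp_mk₀ e φ g (g' := g.hom.restrictScalars K ∘ₗ φ) fun m => rfl]
    exact (koszul_eq_zero_iff e _).mpr (hr Y g hg)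

include e in
-- One class in `Ext^n(C, C)` serves both directions, with `A = C`.
theorem hasAlmostSplitExtensions [IsAlgClosed K] :
    HasAlmostSplitExtensions n (fun M : ModuleCat.{u} R => MemH n M) := by
  refine ⟨fun C h hC => ?_, fun C h hC => ?_⟩
  all_goals
    obtain ⟨η, h0, hl, hr⟩ := exists_almostSplit_class e hC (finiteLength_of_memH e C h)
    exact ⟨C, h, hC, η, h0, fun X f _ => hl X f, fun Y g _ => hr Y g⟩

end AlmostSplitClass

/-! ### From classes in `Ext¹` to short exact sequences -/

section Realization

lemma exists_shortExact_pushout {𝒞 : Type*} [Category 𝒞] [Abelian 𝒞] {S : ShortComplex 𝒞}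
    (hS : S.ShortExact) {A : 𝒞} (a : S.X₁ ⟶ A) :
    ∃ (B : 𝒞) (b : S.X₂ ⟶ B) (f : A ⟶ B) (g : B ⟶ S.X₃) (w : f ≫ g = 0),
      (ShortComplex.mk f g w).ShortExact ∧ S.f ≫ b = a ≫ f ∧ b ≫ g = S.g := by
  have := hS.mono_f
  have := hS.epi_g
  have hw : S.f ≫ S.g = a ≫ 0 := by simp
  have hepi : Epi (Limits.pushout.desc (f := S.f) (g := a) S.g 0 hw) :=
    epi_of_epi_fac (Limits.pushout.inl_desc S.g 0 hw)
  refine ⟨Limits.pushout S.f a, Limits.pushout.inl _ _, Limits.pushout.inr _ _,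
    Limits.pushout.desc S.g 0 hw, Limits.pushout.inr_desc _ _ _, ?_,
    Limits.pushout.condition, Limits.pushout.inl_desc _ _ _⟩
  refine { exact := ShortComplex.exact_of_g_is_cokernel _ ?_, mono_f := ?_, epi_g := hepi }
  · refine Limits.CokernelCofork.IsColimit.ofπ' _ _ fun {Z} k hk => ?_
    have hk' : S.f ≫ Limits.pushout.inl S.f a ≫ k = 0 := by
      rw [Limits.pushout.condition_assoc]
      simp only at hk
      rw [hk, Limits.comp_zero]
    refine ⟨hS.exact.desc _ hk', ?_⟩
    apply Limits.pushout.hom_ext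
    · exact (Limits.pushout.inl_desc_assoc _ _ _ _).trans (hS.exact.g_desc _ hk')
    · refine (Limits.pushout.inr_desc_assoc _ _ _ _).trans ?_
      rw [Limits.zero_comp]
      exact hk.symm
  · exact inferInstanceAs (Mono (Limits.pushout.inr S.f a))

variable {R : Type u} [Ring R]

/-- Every class in `Ext¹` is the class of a short exact sequence. -/
lemma exists_extClass_eq {A C : ModuleCat.{u} R} (y : Ext C A 1) :
    ∃ (B : ModuleCat.{u} R) (f : A ⟶ B) (g : B ⟶ C) (w : f ≫ g = 0)
      (h : (ShortComplex.mk f g w).ShortExact), h.extClass = y := by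
  let π := Projective.π C
  let S : ShortComplex (ModuleCat.{u} R) := ShortComplex.mk (Limits.kernel.ι π) π (by simp)
  have hS : S.ShortExact :=
    { exact := ShortComplex.exact_of_f_is_kernel _ (Limits.kernelIsKernel π)
      mono_f := inferInstanceAs (Mono (Limits.kernel.ι π))
      epi_g := inferInstanceAs (Epi π) }
  -- Pulled back to a projective cover object the class dies, so it is the pushout of the class of
  -- `S` along a map `a` from the kernel.
  have h0 : (Ext.mk₀ S.g).comp y (zero_add 1) = 0 :=
    Ext.eq_zero_of_projective (P := Projective.over C) _
  obtain ⟨x, hx⟩ := Ext.contravariant_sequence_exact₃ hS A y h0 (add_zero 1)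
  obtain ⟨a, rfl⟩ := Ext.homEquiv₀.symm.surjective x
  obtain ⟨B, b, f, g, w, h, h1, h2⟩ := exists_shortExact_pushout hS a
  refine ⟨B, f, g, w, h, ?_⟩
  have := ShortComplex.ShortExact.extClass_naturality
    (f := { τ₁ := a, τ₂ := b, τ₃ := 𝟙 C, comm₁₂ := h1.symm, comm₂₃ := h2.trans (Category.comp_id _).symm }) hS h
  rw [Ext.mk₀_id_comp] at this
  exact this.symm.trans hx

/-- By the long exact sequences, a map lifts to or extends over the middle term once its product
with the extension class vanishes. Here vanishing is needed for all maps that do not split, not only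
for epimorphisms and monomorphisms. -/
lemma isAlmostSplitSequence_of_extClass {S : ShortComplex (ModuleCat.{u} R)} (hS : S.ShortExact)
    (h0 : hS.extClass ≠ 0)
    (hl : ∀ (X : ModuleCat.{u} R) (f : X ⟶ S.X₃), ¬ IsSplitEpi f →
      (Ext.mk₀ f).comp hS.extClass (zero_add 1) = 0)
    (hr : ∀ (Y : ModuleCat.{u} R) (g : S.X₁ ⟶ Y), ¬ IsSplitMono g →
      hS.extClass.comp (Ext.mk₀ g) (add_zero 1) = 0) : IsAlmostSplitSequence S := by
  refine ⟨hS, fun h => h0 ?_, fun X f hf => ?_, fun Y g hg => ?_⟩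
  · rw [← Ext.mk₀_id_comp hS.extClass, ← IsSplitEpi.id S.g, ← Ext.mk₀_comp_mk₀,
      Ext.comp_assoc_of_second_deg_zero, hS.comp_extClass, Ext.comp_zero]
  · obtain ⟨x, hx⟩ := Ext.covariant_sequence_exact₃ X hS (Ext.mk₀ f) (zero_add 1) (hl X f hf)
    obtain ⟨h, rfl⟩ := Ext.homEquiv₀.symm.surjective x
    refine ⟨h, Ext.homEquiv₀.symm.injective ?_⟩
    exact (Ext.mk₀_comp_mk₀ h S.g).symm.trans hx
  · obtain ⟨x, hx⟩ := Ext.contravariant_sequence_exact₁ hS Y (Ext.mk₀ g) (add_zero 1) (hr Y g hg)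
    obtain ⟨h, rfl⟩ := Ext.homEquiv₀.symm.surjective x
    refine ⟨h, Ext.homEquiv₀.symm.injective ?_⟩
    exact (Ext.mk₀_comp_mk₀ S.f h).symm.trans hx

lemma isFiniteLength_of_shortExact {S : ShortComplex (ModuleCat.{u} R)} (hS : S.ShortExact)
    (h1 : IsFiniteLength R S.X₁) (h3 : IsFiniteLength R S.X₃) : IsFiniteLength R S.X₂ := by
  rw [isFiniteLength_iff_isNoetherian_isArtinian] at *
  obtain ⟨_, _⟩ := h1
  obtain ⟨_, _⟩ := h3
  have hex : LinearMap.range S.f.hom = LinearMap.ker S.g.hom :=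
    hS.exact.moduleCat_range_eq_ker
  exact ⟨isNoetherian_of_range_eq_ker _ _ hex, isArtinian_of_range_eq_ker _ _ hex⟩

end Realization

theorem hasAlmostSplitSequences {K R : Type u} [Field K] [IsAlgClosed K] [CommRing R] [Algebra K R]
    (e : MvPolynomial (Fin 1) K ≃ₐ[K] R) :
    HasAlmostSplitSequences (fun M : ModuleCat.{u} R => MemH 1 M) := by
  refine ⟨fun C h hC => ?_, fun C h hC => ?_⟩
  all_goals
    have hfl := finiteLength_of_memH e C h
    obtain ⟨η, h0, hl, hr⟩ := exists_almostSplit_class e hC hfl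
    obtain ⟨B, f, g, w, hS, rfl⟩ := exists_extClass_eq η
    have hB : MemH 1 B :=
      memH_of_finiteLength e one_pos B (isFiniteLength_of_shortExact hS hfl hfl)
    have := isAlmostSplitSequence_of_extClass hS h0 hl hr
  · exact ⟨_, this, ⟨Iso.refl C⟩, h, hB, hC⟩
  · exact ⟨_, this, ⟨Iso.refl C⟩, hB, h, hC⟩

/-! ### Global dimension and the conditions on simple modules -/

section Regular

lemma isSimpleModule_restrictScalars_iff {A B : Type u} [Ring A] [Ring B] (σ : A ≃+* B)
    (M : ModuleCat.{u} B) :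
    IsSimpleModule A ((ModuleCat.restrictScalars σ.toRingHom).obj M) ↔ IsSimpleModule B M := by
  have : RingHomSurjective σ.toRingHom := ⟨σ.surjective⟩
  let l : (ModuleCat.restrictScalars σ.toRingHom).obj M →ₛₗ[σ.toRingHom] M :=
    { toFun := fun m => m
      map_add' := fun _ _ => rfl
      map_smul' := fun _ _ => rfl }
  exact LinearMap.isSimpleModule_iff_of_bijective l Function.bijective_id

lemma isFiniteLength_of_isSimpleModule (R : Type u) [Ring R] (S : Type u) [AddCommGroup S]
    [Module R S] [IsSimpleModule R S] : IsFiniteLength R S :=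
  isFiniteLength_iff_isNoetherian_isArtinian.mpr ⟨inferInstance, inferInstance⟩

variable {K R : Type u} [Field K] [IsAlgClosed K] [CommRing R] [Algebra K R] {n : ℕ}
  (e : MvPolynomial (Fin n) K ≃ₐ[K] R)

include e in
lemma memH_of_isSimpleModule (hn : 0 < n) (S : ModuleCat.{u} R) [IsSimpleModule R S] :
    MemH n S :=
  memH_of_finiteLength e hn S (isFiniteLength_of_isSimpleModule R S)

include e in
lemma globalDimension_eq (hn : 0 < n) : globalDimension R = n := by
  have := isDomain_of_algEquiv e
  obtain ⟨I, hI⟩ := Ideal.exists_maximal R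
  have : IsSimpleModule R (R ⧸ I) := isSimpleModule_iff_isCoatom.mpr hI.out
  have : Nontrivial (ModuleCat.of R (R ⧸ I)) := IsSimpleModule.nontrivial R (R ⧸ I)
  refine le_antisymm (iSup_le (projectiveDimension_le e)) ?_
  refine le_iSup_of_le (ModuleCat.of R (R ⧸ I)) ?_
  exact (projectiveDimension_eq_of_finiteLength e hn _
    (isFiniteLength_of_isSimpleModule R (R ⧸ I))).ge

include e in
lemma isSimpleModule_tr (S : ModuleCat.{u} R) [IsSimpleModule R S] :
    IsSimpleModule Rᵐᵒᵖ (tr n S) := by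
  obtain ⟨f⟩ := tr_simple_equiv e S
  exact (isSimpleModule_restrictScalars_iff (RingEquiv.toOpposite R) (tr n S)).mp
    (IsSimpleModule.congr f)

include e in
lemma isSimpleModule_ofOpOp_tr (S : ModuleCat.{u} Rᵐᵒᵖ) [IsSimpleModule Rᵐᵒᵖ S] :
    IsSimpleModule R (ofOpOp (tr n S)) :=
  (isSimpleModule_restrictScalars_iff (RingEquiv.opOp R) (tr n S)).mpr
    (isSimpleModule_tr (e.trans (AlgEquiv.toOpposite K R)) S)

include e in
lemma hasSimpleSubmoduleInH_of_isSimpleModule (hn : 0 < n) (X : ModuleCat.{u} R)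
    [IsSimpleModule R X] : HasSimpleSubmoduleInH n X := by
  have : IsSimpleModule R (⊤ : Submodule R X) := IsSimpleModule.congr Submodule.topEquiv
  exact ⟨⊤, this, memH_of_isSimpleModule e hn (ModuleCat.of R (⊤ : Submodule R X))⟩

end Regular

/-! ### The standard grading of the polynomial ring -/

section Grading

variable (K : Type u) [Field K] (n : ℕ)

lemma mem_iSup_homogeneousSubmodule_succ_iff (p : MvPolynomial (Fin n) K) :
    p ∈ ⨆ i, MvPolynomial.homogeneousSubmodule (Fin n) K (i + 1) ↔ p.coeff 0 = 0 := by
  constructor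
  · intro hp
    have : ⨆ i, MvPolynomial.homogeneousSubmodule (Fin n) K (i + 1) ≤
        LinearMap.ker (MvPolynomial.lcoeff K (0 : Fin n →₀ ℕ)) :=
      iSup_le fun i q (hq : q.IsHomogeneous (i + 1)) => hq.coeff_eq_zero (by simp)
    exact this hp
  · intro hp
    rw [← MvPolynomial.sum_homogeneousComponent p]
    refine Submodule.sum_mem _ fun i _ => ?_
    cases i with
    | zero => simp [MvPolynomial.homogeneousComponent_zero, hp]
    | succ i =>
      exact Submodule.mem_iSup_of_mem (p := fun i =>
        MvPolynomial.homogeneousSubmodule (Fin n) K (i + 1)) i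
          (MvPolynomial.homogeneousComponent_mem _ p)

lemma mem_span_range_X_iff (p : MvPolynomial (Fin n) K) :
    p ∈ Ideal.span (Set.range MvPolynomial.X) ↔ p.coeff 0 = 0 := by
  rw [← Set.image_univ, MvPolynomial.mem_ideal_span_X_image]
  constructor
  · intro h
    by_contra h0
    obtain ⟨i, -, hi⟩ := h 0 (MvPolynomial.mem_support_iff.mpr h0)
    exact hi rfl
  · intro h m hm
    by_contra! hm0
    have : m = 0 := Finsupp.ext fun i => hm0 i trivial
    exact MvPolynomial.mem_support_iff.mp hm (this ▸ h)

lemma span_op_eq_span {R : Type u} [CommRing R] (s : Set R) :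
    (Submodule.span Rᵐᵒᵖ s : Set R) = Submodule.span R s := by
  apply Set.Subset.antisymm
  · intro x hx
    induction hx using Submodule.span_induction with
    | mem x hx => exact Submodule.subset_span hx
    | zero => exact zero_mem _
    | add x y _ _ hx hy => exact add_mem hx hy
    | smul a x _ hx =>
      have := Submodule.smul_mem _ a.unop hx
      rwa [smul_eq_mul, mul_comm] at this
  · intro x hx
    induction hx using Submodule.span_induction with
    | mem x hx => exact Submodule.subset_span hx
    | zero => exact zero_mem _
    | add x y _ _ hx hy => exact add_mem hx hy
    | smul a x _ hx =>
      have := Submodule.smul_mem _ (MulOpposite.op a) hx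
      rwa [op_smul_eq_mul, mul_comm] at this

lemma hasPositiveGrading : HasPositiveGrading (MvPolynomial (Fin n) K) K := by
  classical
  let s : Finset (MvPolynomial (Fin n) K) := Finset.univ.image MvPolynomial.X
  have hs : (Submodule.span (MvPolynomial (Fin n) K) (s : Set (MvPolynomial (Fin n) K)) :
      Set (MvPolynomial (Fin n) K)) =
        ((⨆ i : ℕ, MvPolynomial.homogeneousSubmodule (Fin n) K (i + 1) :
          Submodule K (MvPolynomial (Fin n) K)) : Set (MvPolynomial (Fin n) K)) := by
    ext p
    rw [Finset.coe_image, Finset.coe_univ, Set.image_univ]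
    exact (mem_span_range_X_iff K n p).trans
      (mem_iSup_homogeneousSubmodule_succ_iff K n p).symm
  let := MvPolynomial.gradedAlgebra (σ := Fin n) (R := K)
  -- Here `t = 1`, as the degree-zero part is `K`; the variables generate `R_{≥ 1}`, since both
  -- sides consist of the polynomials without constant term.
  refine ⟨MvPolynomial.homogeneousSubmodule (Fin n) K, inferInstance, ⟨1, ?_⟩, fun i => ?_,
    ⟨s, hs⟩, ⟨s, (span_op_eq_span _).trans hs⟩⟩
  · have hbij : Function.Bijective
        (Algebra.ofId K (MvPolynomial.homogeneousSubmodule (Fin n) K 0)) := by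
      refine ⟨fun a b hab => ?_, fun p => ?_⟩
      · exact (MvPolynomial.C_injective (Fin n) K) (congrArg Subtype.val hab)
      have hp : MvPolynomial.IsHomogeneous (p : MvPolynomial (Fin n) K) 0 := p.2
      rw [← MvPolynomial.totalDegree_zero_iff_isHomogeneous,
        MvPolynomial.totalDegree_eq_zero_iff_eq_C] at hp
      exact ⟨_, Subtype.ext hp.symm⟩
    exact ⟨(AlgEquiv.ofBijective _ hbij).symm.trans (AlgEquiv.funUnique K (Fin 1) K).symm⟩
  · exact Module.Finite.iff_fg.mpr (MvPolynomial.homogeneousSubmodule_fg (Fin n) K i)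

end Grading

theorem isGeneralizedASRegular (K : Type u) [Field K] [IsAlgClosed K] {n : ℕ} (hn : 0 < n) :
    IsGeneralizedASRegular (MvPolynomial (Fin n) K) K n := by
  have e : MvPolynomial (Fin n) K ≃ₐ[K] MvPolynomial (Fin n) K := AlgEquiv.refl
  -- By commutativity the opposite ring is a polynomial ring too, so the right-module conditions
  -- follow from the same lemmas.
  have e' : MvPolynomial (Fin n) K ≃ₐ[K] (MvPolynomial (Fin n) K)ᵐᵒᵖ := AlgEquiv.toOpposite K _
  exact
    { semiperfect_or_graded := .inr (hasPositiveGrading K n)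
      globalDimension_eq := globalDimension_eq e hn
      globalDimension_op_eq := globalDimension_eq e' hn
      simple_mem := fun S _ _ => memH_of_isSimpleModule e hn S
      simple_mem_op := fun S _ _ => memH_of_isSimpleModule e' hn S
      tr_simple := fun S _ _ => by
        have := isSimpleModule_tr e S
        exact hasSimpleSubmoduleInH_of_isSimpleModule e' hn (tr n S)
      tr_simple_op := fun S _ _ => by
        have := isSimpleModule_ofOpOp_tr e S
        exact hasSimpleSubmoduleInH_of_isSimpleModule e hn (ofOpOp (tr n S)) }

end ASRegular

theorem mainTheorem10 (K : Type u) [Field K] [IsAlgClosed K] (n : ℕ) (hn : 0 < n) :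
    (∀ S : ModuleCat.{u} (MvPolynomial (Fin n) K), IsSimpleModule (MvPolynomial (Fin n) K) S →
      ASRegular.MemH n S ∧ Nonempty (ASRegular.ofOp (ASRegular.tr n S) ≅ S)) ∧
    ASRegular.IsGeneralizedASRegular (MvPolynomial (Fin n) K) K n ∧
    (∀ M : ModuleCat.{u} (MvPolynomial (Fin n) K),
      ASRegular.MemH n M ↔ IsFiniteLength (MvPolynomial (Fin n) K) M) ∧
    ASRegular.HasAlmostSplitExtensions n
      (fun M : ModuleCat.{u} (MvPolynomial (Fin n) K) => ASRegular.MemH n M) ∧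
    (n = 1 → ASRegular.HasAlmostSplitSequences
      (fun M : ModuleCat.{u} (MvPolynomial (Fin n) K) => ASRegular.MemH n M)) := by
  have e : MvPolynomial (Fin n) K ≃ₐ[K] MvPolynomial (Fin n) K := AlgEquiv.refl
  refine ⟨fun S _ => ⟨ASRegular.memH_of_isSimpleModule e hn S, ?_⟩,
    ASRegular.isGeneralizedASRegular K hn, fun M => ⟨ASRegular.finiteLength_of_memH e M,
      ASRegular.memH_of_finiteLength e hn M⟩, ASRegular.hasAlmostSplitExtensions e, ?_⟩
  · exact (ASRegular.tr_simple_equiv e S).map LinearEquiv.toModuleIso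
  · rintro rfl
    exact ASRegular.hasAlmostSplitSequences e
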